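/- **Setting.** Let $G=(X,w,\kappa,\mu)$ be a connected weighted graph: $X$ is countable, $w:X\times X\to[0,\infty)$ is symmetric with $w(x,x)=0$ and $\sum_y w(x,y)<\infty$ for all $x$, $\kappa:X\to[0,\infty)$, $\mu:X\to(0,\infty)$, and any two nodes are joined by a finite walk along pairs with $w\neq 0$. For $1\le p<\infty$ let $\ell^p=\ell^p(X,\mu)$ with $\|u\|_p=(\sum_x|u(x)|^p\mu(x))^{1/p}$, and $$\Delta u(x)=\frac1{\mu(x)}\sum_y w(x,y)(u(x)-u(y))+\frac{\kappa(x)}{\mu(x)}u(x)$$ for those $u$ with $\sum_y w(x,y)|u(y)|<\infty$ for all $x$. Let $q\in(0,1)\cup(1,\infty)$, $f(s)=-|s|^{q-1}s$, $\mathcal A u=\Delta u-f(u)$, and let $\operatorname{dom}_p(\mathcal A)$ be the set of $u\in\ell^p$ in the domain of $\Delta$ with $\mathcal A u\in\ell^p$. For an increasing exhaustion $(X_n)$ of $X$ by finite sets, let $\mathcal A_n u$ be obtained by restricting $u$ to $X_n$, applying $\Delta-f$ with $\Delta$ the Laplacian of the Dirichlet subgraph on $X_n$ (weights and measure restricted,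 killing term $\kappa(x)+\sum_{z\notin X_n}w(x,z)$), and extending by $0$. Let $\Omega_p$ be the set of $u\in\operatorname{dom}_p(\mathcal A)$ for which there are $u_n$ supported in $X_n$ with $\|u_n-u\|_p\to0$ and $\|\mathcal A_nu_n-\mathcal Au\|_p\to0$. For $D\subseteq \operatorname{dom}_p(\mathcal A)$, a *mild solution with values in $D$* of $$\partial_tu+\Delta u+|u|^{q-1}u=0,\qquad u(0)=u_0 \tag{P}$$ is a function $u:[0,\infty)\to\ell^p$ such that on each $[0,a]$, $a>0$, $u$ is continuous into $\ell^p$ and for every $\epsilon>0$ there are $0=t_0<\dots<t_N\le a$ with $\lambda_k:=t_k-t_{k-1}\le\epsilon$, $a-t_N\le\epsilon$, elements $h_k\in\ell^p$ with $\sum_{k=1}^N\lambda_k\|h_k\|_p\le\epsilon$, and $u_k\in D$ with $u_k+\lambda_k\mathcal A u_k=u_{k-1}+\lambda_kh_k$ ($1\le k\le N$), such that $\|u(t)-u_\epsilon(t)\|_p<\epsilon$ for all $t\in[0,t_N]$, where $u_\epsilon(0)=u_0$ and $u_\epsilon=u_k$ on $(t_{k-1},t_k]$. **Theorem.** Let $G$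 be a connected graph and $1\le p<\infty$; if $p>1$, assume $\sum_y w(x,y)^p\mu(y)^{1-p}<\infty$ for every $x\in X$. Let $q\in(0,1)\cup(1,\infty)$, $0\le u_0\in\ell^p(X,\mu)\cap\ell^\infty(X)$ and $M:=\|u_0\|_\infty$. There is a mild solution $u$ of (P) with values in $\operatorname{dom}_p(\mathcal A)$ which, for every increasing exhaustion of $X$ by finite sets, is the unique mild solution with values in the corresponding $\Omega_p$. It satisfies: 1. if $q\in(0,1)$, then $0\le u(t,x)\le\bigl[M^{1-q}-(1-q)t\bigr]_+^{\frac1{1-q}}$ for all $t>0$, $x\in X$; in particular $u(t,\cdot)\equiv0$ for all $t\ge T_*:=\frac{M^{1-q}}{1-q}$; 2. if $q>1$ and $u_0\not\equiv0$, then $0<u(t,x)\le\Bigl[\frac1{M^{q-1}}+(q-1)t\Bigr]^{-\frac1{q-1}}$ for all $t>0$, $x\in X$. -/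

import Mathlib

open Filter Topology

/-- A weighted graph `(X, w, κ, μ)` on the node set `X`: edge weights `w ≥ 0` (symmetric, without
loops, with finite sums over neighbours), a killing term `κ ≥ 0` and a node measure `μ > 0`. -/
structure WeightedGraph (X : Type*) where
  w : X → X → ℝ
  κ : X → ℝ
  μ : X → ℝ
  w_nonneg : ∀ x y, 0 ≤ w x y
  κ_nonneg : ∀ x, 0 ≤ κ x
  μ_pos : ∀ x, 0 < μ x
  w_symm : ∀ x y, w x y = w y x
  w_self : ∀ x, w x x = 0
  w_summable : ∀ x, Summable (w x)

namespace WeightedGraph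

variable {X : Type*}

/-- Any two nodes are joined by a finite walk along edges of nonzero weight. -/
def IsConnected (G : WeightedGraph X) : Prop :=
  ∀ x y, Relation.ReflTransGen (fun a b => G.w a b ≠ 0) x y

/-- `u ∈ ℓ^p(X, μ)`, for `1 ≤ p < ∞`. -/
def MemEllp (G : WeightedGraph X) (p : ℝ) (u : X → ℝ) : Prop :=
  Summable fun x => |u x| ^ p * G.μ x

/-- The norm of `ℓ^p(X, μ)`, for `1 ≤ p < ∞`. -/
noncomputable def ellpNorm (G : WeightedGraph X) (p : ℝ) (u : X → ℝ) : ℝ :=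
  (∑' x, |u x| ^ p * G.μ x) ^ (1 / p)

/-- The condition `∑_y w(x,y)^p / μ(y)^(p-1) < ∞` for every node `x`. -/
def CondC (G : WeightedGraph X) (p : ℝ) : Prop :=
  ∀ x, Summable fun y => G.w x y ^ p / G.μ y ^ (p - 1)

/-- The domain of the formal graph Laplacian. -/
def lapDom (G : WeightedGraph X) : Set (X → ℝ) :=
  {u | ∀ x, Summable fun y => G.w x y * |u y|}

/-- The formal (nonnegative) graph Laplacian `Δ`. -/
noncomputable def lap (G : WeightedGraph X) (u : X → ℝ) (x : X) : ℝ :=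
  1 / G.μ x * ∑' y, G.w x y * (u x - u y) + G.κ x / G.μ x * u x

/-- The action of the operator `𝒜 = F + Δ`, where `F u = -f(u)`. -/
noncomputable def opA (G : WeightedGraph X) (f : ℝ → ℝ) (u : X → ℝ) (x : X) : ℝ :=
  -f (u x) + G.lap u x

/-- The domain `dom_p(𝒜)` of `𝒜` in `ℓ^p(X, μ)`. -/
def domA (G : WeightedGraph X) (p : ℝ) (f : ℝ → ℝ) : Set (X → ℝ) :=
  {u | G.MemEllp p u ∧ u ∈ G.lapDom ∧ G.MemEllp p (G.opA f u)}

/-- The Dirichlet subgraph on `Y ⊆ X`: weights and measure are restricted to `Y` and the killing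
term is increased by the total weight of the edges that leave `Y`. -/
noncomputable def dirichlet (G : WeightedGraph X) (Y : Set X) : WeightedGraph Y where
  w x y := G.w x y
  κ x := G.κ x + ∑' z : (Yᶜ : Set X), G.w x z
  μ x := G.μ x
  w_nonneg x y := G.w_nonneg x y
  κ_nonneg x := add_nonneg (G.κ_nonneg x) (tsum_nonneg fun z => G.w_nonneg x z)
  μ_pos x := G.μ_pos x
  w_symm x y := G.w_symm x y
  w_self x := G.w_self x
  w_summable x := (G.w_summable x).comp_injective Subtype.val_injective

open Classical in
/-- For `Y ⊆ X`, the operator `𝔦 (F + Δ_dir) π`: restrict to `Y`, apply `F` plus the Laplacian of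
the Dirichlet subgraph on `Y`, and extend by zero. -/
noncomputable def opADir (G : WeightedGraph X) (f : ℝ → ℝ) (Y : Set X) (u : X → ℝ) (x : X) : ℝ :=
  if hx : x ∈ Y then (G.dirichlet Y).opA f (fun y : Y => u y) ⟨x, hx⟩ else 0

/-- An increasing exhaustion of `X` by finite sets. -/
structure IsExhaustion (E : ℕ → Finset X) : Prop where
  mono : Monotone E
  cover : ∀ x, ∃ n, x ∈ E n

/-- The set `Ω_p ⊆ dom_p(𝒜)` that belongs to the exhaustion `E`: those `u ∈ dom_p(𝒜)` for which
there are `uₙ` supported in `E n` with `uₙ → u` and `𝒜ₙ uₙ → 𝒜 u` in `ℓ^p(X, μ)`, where `𝒜ₙ` is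
the operator of the Dirichlet subgraph on `E n`. -/
def Omega (G : WeightedGraph X) (p : ℝ) (f : ℝ → ℝ) (E : ℕ → Finset X) : Set (X → ℝ) :=
  {u | u ∈ G.domA p f ∧ ∃ v : ℕ → X → ℝ,
    (∀ n, Function.support (v n) ⊆ (E n : Set X)) ∧
    Tendsto (fun n => G.ellpNorm p (v n - u)) atTop (𝓝 0) ∧
    Tendsto (fun n => G.ellpNorm p (G.opADir f (E n : Set X) (v n) - G.opA f u)) atTop (𝓝 0)}

/-- `(t_k)_{0 ≤ k ≤ N}` and `(h_k)_{1 ≤ k ≤ N}` form an `ε`-discretization of `([0,T]; h)`. -/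
structure IsDiscretization (G : WeightedGraph X) (p T ε : ℝ) (h : ℝ → X → ℝ)
    (N : ℕ) (t : ℕ → ℝ) (hd : ℕ → X → ℝ) : Prop where
  t_zero : t 0 = 0
  t_lt : ∀ k < N, t k < t (k + 1)
  t_le : t N ≤ T
  step_le : ∀ k < N, t (k + 1) - t k ≤ ε
  last_le : T - t N ≤ ε
  mem : ∀ k < N, G.MemEllp p (hd (k + 1))
  integrable : ∀ k < N, IntervalIntegrable (fun s => G.ellpNorm p (h s - hd (k + 1)))
    MeasureTheory.volume (t k) (t (k + 1))
  error_le : ∑ k ∈ Finset.range N,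
    ∫ s in (t k)..(t (k + 1)), G.ellpNorm p (h s - hd (k + 1)) ≤ ε

/-- `(v_k)_{0 ≤ k ≤ N}` solves the implicit Euler scheme for the restriction of `𝒜` to `D`:
`v_0 = u₀`, `v_k ∈ D` and `(id + λ_k 𝒜) v_k = v_{k-1} + λ_k h_k` with `λ_k = t_k - t_{k-1}`. -/
def IsEulerSequence (G : WeightedGraph X) (f : ℝ → ℝ) (D : Set (X → ℝ)) (u₀ : X → ℝ)
    (N : ℕ) (t : ℕ → ℝ) (hd v : ℕ → X → ℝ) : Prop :=
  v 0 = u₀ ∧ ∀ k < N, v (k + 1) ∈ D ∧ ∀ x,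
    v (k + 1) x + (t (k + 1) - t k) * G.opA f (v (k + 1)) x
      = v k x + (t (k + 1) - t k) * hd (k + 1) x

/-- The piecewise constant function equal to `v_0` at time `0` and to `v_k` on `(t_{k-1}, t_k]`. -/
noncomputable def stepFun (N : ℕ) (t : ℕ → ℝ) (v : ℕ → X → ℝ) (s : ℝ) (x : X) : ℝ :=
  if s = 0 then v 0 x
  else ∑ k ∈ Finset.range N, (Set.Ioc (t k) (t (k + 1))).indicator (fun _ => v (k + 1) x) s

/-- `u` is a mild solution on `[0,T]` of `∂ₜu + 𝒜u = h`, `u(0) = u₀`, where `𝒜` has the domain `D`: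
`u ∈ C([0,T]; ℓ^p(X, μ))`, and for every `ε > 0` there is an `ε`-approximate solution, with values
`v_k ∈ D`, at distance less than `ε` from `u`. -/
def IsMildSolutionOn (G : WeightedGraph X) (p : ℝ) (f : ℝ → ℝ) (D : Set (X → ℝ))
    (h : ℝ → X → ℝ) (u₀ : X → ℝ) (T : ℝ) (u : ℝ → X → ℝ) : Prop :=
  (∀ s ∈ Set.Icc 0 T, G.MemEllp p (u s)) ∧
  (∀ s ∈ Set.Icc 0 T,
    Tendsto (fun r => G.ellpNorm p (u r - u s)) (𝓝[Set.Icc 0 T] s) (𝓝 0)) ∧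
  ∀ ε > 0, ∃ (N : ℕ) (t : ℕ → ℝ) (hd v : ℕ → X → ℝ),
    G.IsDiscretization p T ε h N t hd ∧ G.IsEulerSequence f D u₀ N t hd v ∧
    ∀ s ∈ Set.Icc 0 (t N), G.ellpNorm p (u s - stepFun N t v s) < ε

/-- `u` is a mild solution on `[0,∞)`: its restriction to every `[0,a]` is a mild solution. -/
def IsMildSolution (G : WeightedGraph X) (p : ℝ) (f : ℝ → ℝ) (D : Set (X → ℝ))
    (h : ℝ → X → ℝ) (u₀ : X → ℝ) (u : ℝ → X → ℝ) : Prop :=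
  ∀ a > 0, G.IsMildSolutionOn p f D h u₀ a u

end WeightedGraph

/-- The absorption term `f(s) = -|s|^(q-1) s`. -/
noncomputable def absorption (q : ℝ) (s : ℝ) : ℝ := -(|s| ^ (q - 1) * s)

/-! The equation is treated as an evolution governed by an accretive operator, and the solution is
the limit of implicit Euler schemes in the spirit of Crandall and Liggett. The graph supplies three
ingredients. Accretivity: on a finite Dirichlet subgraph, symmetry of the weights and monotonicity
of the absorption make `𝒜ₙ` accretive in `ℓ^p`. The defining approximation property of `Ω_p` carries
the inequality to the limit (`isAccretive_omega`). Range condition: for bounded nonnegative `g` in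
`ℓ^p`, the equation `u + l𝒜u = g` has a least nonnegative solution, found by Perron's method. It is
the increasing limit of the solutions on the finite sets, hence lies in `Ω_p` for every exhaustion
(`mem_omega_of_least`). Density: the summability condition on the weights puts finitely supported
functions into every `Ω_p`, and these are dense (`mem_omega_of_support`). Kobayashi's estimate for
two Euler schemes then gives convergence of the schemes built from least solutions, and also
uniqueness. Since these resolvents do not depend on an exhaustion, one function serves all
exhaustions.

The bounds are proved for the scheme and then passed to the limit. A spatial constant that performs
one implicit step of `z' = -z^q` is a supersolution, so minimality keeps the scheme below the scalar
one, whose limit is the explicit barrier. For `q > 1` and bounded `v`, the absorption is at most a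
multiple of `v`. The scheme therefore decays at most exponentially at a node where `u₀ > 0`, and
positivity spreads along walks with lower bounds uniform in the step size. -/

/-! ### Accretive operators and Kobayashi's estimate for implicit Euler schemes. -/

section Accretive

variable {B : Type*} [NormedAddCommGroup B] [NormedSpace ℝ B]

/-- A (possibly multivalued) operator, given by its graph, is accretive. -/
def IsAccretive (A : Set (B × B)) : Prop :=
  ∀ a ∈ A, ∀ b ∈ A, ∀ l : ℝ, 0 < l → ‖a.1 - b.1‖ ≤ ‖a.1 - b.1 + l • (a.2 - b.2)‖

/-- The implicit Euler scheme for the operator with graph `A`, with error terms `h`. -/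
structure IsEulerScheme (A : Set (B × B)) (N : ℕ) (t : ℕ → ℝ) (h v : ℕ → B) : Prop where
  t_zero : t 0 = 0
  t_lt : ∀ k < N, t k < t (k + 1)
  step : ∀ k < N, ∃ y, (v (k + 1), y) ∈ A ∧
    v (k + 1) + (t (k + 1) - t k) • y = v k + (t (k + 1) - t k) • h (k + 1)

theorem IsAccretive.mono {A A' : Set (B × B)} (hA : IsAccretive A) (h : A' ⊆ A) :
    IsAccretive A' := fun a ha b hb => hA a (h ha) b (h hb)

/-- Accretivity against the fixed pair `(x, y)` costs `l * ‖y‖` per step. This supplies the boundary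
values of the double induction in Kobayashi's estimate. -/
theorem IsEulerScheme.norm_sub_point_le {A : Set (B × B)} (hA : IsAccretive A) {N : ℕ} {t : ℕ → ℝ}
    {h v : ℕ → B} (H : IsEulerScheme A N t h v) {x y : B} (hxy : (x, y) ∈ A) :
    ∀ k ≤ N, ‖v k - x‖ ≤ ‖v 0 - x‖ + t k * ‖y‖ +
      ∑ i ∈ Finset.range k, (t (i + 1) - t i) * ‖h (i + 1)‖ := by
  intro k
  induction k with
  | zero => intro _; simp [H.t_zero]
  | succ k ih =>
    intro hk
    have ih := ih (by omega)
    obtain ⟨z, hz, he⟩ := H.step k (by omega)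
    have hl : 0 < t (k + 1) - t k := sub_pos.2 (H.t_lt k (by omega))
    set l := t (k + 1) - t k with hl_def
    have h1 := hA _ hz _ hxy l hl
    have h2 : v (k + 1) - x + l • (z - y) = (v k - x) + l • h (k + 1) - l • y := by
      rw [smul_sub]
      have : l • z = v k + l • h (k + 1) - v (k + 1) := by rw [← he]; abel
      rw [this]; abel
    simp only at h1
    rw [h2] at h1
    have h3 : ‖(v k - x) + l • h (k + 1) - l • y‖ ≤ ‖v k - x‖ + l * ‖h (k + 1)‖ + l * ‖y‖ := by
      refine (norm_sub_le _ _).trans ?_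
      refine add_le_add ((norm_add_le _ _).trans ?_) ?_ <;> simp [norm_smul, abs_of_pos hl]
    rw [Finset.sum_range_succ]
    have : t (k + 1) = t k + l := by simp [hl_def]
    rw [this, add_sub_cancel_left]
    linarith

/-- One step of the comparison of two Euler schemes with step sizes `l` and `d`. -/
theorem IsAccretive.two_step {A : Set (B × B)} (hA : IsAccretive A) {l d : ℝ} (hl : 0 < l)
    (hd : 0 < d) {v v' a h u u' b g : B} (hv : (v, a) ∈ A) (hu : (u, b) ∈ A)
    (ev : v + l • a = v' + l • h) (eu : u + d • b = u' + d • g) :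
    (l + d) * ‖v - u‖ ≤ d * ‖v' - u‖ + l * ‖v - u'‖ + l * d * (‖h‖ + ‖g‖) := by
  have hs : 0 < l + d := by positivity
  -- With this parameter, multiplication by `l + d` produces `d • (l • a) - l • (d • b)`, so both
  -- scheme equations can be substituted.
  have h1 := hA _ hv _ hu (l * d / (l + d)) (by positivity)
  simp only at h1
  have e : (l + d) • (v - u + (l * d / (l + d)) • (a - b))
      = d • (v' - u) + l • (v - u') + (l * d) • (h - g) := by
    have ea : l • a = v' + l • h - v := by rw [← ev]; abel
    have eb : d • b = u' + d • g - u := by rw [← eu]; abel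
    rw [smul_add, smul_smul, mul_div_cancel₀ _ hs.ne']
    have : (l * d) • (a - b) = d • (l • a) - l • (d • b) := by
      rw [smul_sub, smul_smul, smul_smul, mul_comm d l]
    rw [this, ea, eb]
    module
  calc (l + d) * ‖v - u‖ ≤ (l + d) * ‖v - u + (l * d / (l + d)) • (a - b)‖ := by gcongr
    _ = ‖(l + d) • (v - u + (l * d / (l + d)) • (a - b))‖ := by
        rw [norm_smul, Real.norm_of_nonneg hs.le]
    _ = ‖d • (v' - u) + l • (v - u') + (l * d) • (h - g)‖ := by rw [e]
    _ ≤ ‖d • (v' - u)‖ + ‖l • (v - u')‖ + ‖(l * d) • (h - g)‖ := norm_add₃_le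
    _ ≤ _ := by
        rw [norm_smul, norm_smul, norm_smul, Real.norm_of_nonneg hl.le, Real.norm_of_nonneg hd.le,
          Real.norm_of_nonneg (by positivity)]
        gcongr
        exact norm_sub_le _ _

/-- The terms linear in `D` cancel in the weighted mean of the two radicands, which equals the
radicand on the right; concavity of the square root does the rest. Thus the square root in
Kobayashi's estimate reproduces itself under `IsAccretive.two_step`. -/
theorem sqrt_two_step {l d D P Q : ℝ} (hl : 0 < l) (hd : 0 < d) (hP : 0 ≤ P) (hQ : 0 ≤ Q) :
    d * √((D - l) ^ 2 + P + (Q + d ^ 2)) + l * √((D + d) ^ 2 + (P + l ^ 2) + Q)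
      ≤ (l + d) * √(D ^ 2 + (P + l ^ 2) + (Q + d ^ 2)) := by
  set α := √((D - l) ^ 2 + P + (Q + d ^ 2))
  set β := √((D + d) ^ 2 + (P + l ^ 2) + Q)
  set γ := √(D ^ 2 + (P + l ^ 2) + (Q + d ^ 2))
  have ha : α ^ 2 = (D - l) ^ 2 + P + (Q + d ^ 2) := Real.sq_sqrt (by positivity)
  have hb : β ^ 2 = (D + d) ^ 2 + (P + l ^ 2) + Q := Real.sq_sqrt (by positivity)
  have hc : γ ^ 2 = D ^ 2 + (P + l ^ 2) + (Q + d ^ 2) := Real.sq_sqrt (by positivity)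
  have hα : 0 ≤ α := Real.sqrt_nonneg _
  have hβ : 0 ≤ β := Real.sqrt_nonneg _
  have hγ : 0 ≤ γ := Real.sqrt_nonneg _
  refine le_of_sq_le_sq ?_ (by positivity)
  have h1 : ((l + d) * γ) ^ 2 = (l + d) * (d * α ^ 2 + l * β ^ 2) := by
    rw [mul_pow, ha, hb, hc]; ring
  rw [h1]
  nlinarith [mul_nonneg (mul_nonneg hl.le hd.le) (sq_nonneg (α - β))]

/-- Kobayashi's estimate for two Euler schemes of an accretive operator. -/
theorem IsEulerScheme.norm_sub_le_sqrt {A : Set (B × B)} (hA : IsAccretive A) {N M : ℕ}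
    {t s : ℕ → ℝ} {h v g u : ℕ → B} (H : IsEulerScheme A N t h v) (H' : IsEulerScheme A M s g u)
    {x y : B} (hxy : (x, y) ∈ A) :
    ∀ k ≤ N, ∀ j ≤ M, ‖v k - u j‖ ≤ ‖v 0 - x‖ + ‖u 0 - x‖ +
      √((t k - s j) ^ 2 + ∑ i ∈ Finset.range k, (t (i + 1) - t i) ^ 2
        + ∑ i ∈ Finset.range j, (s (i + 1) - s i) ^ 2) * ‖y‖ +
      ∑ i ∈ Finset.range k, (t (i + 1) - t i) * ‖h (i + 1)‖ +
      ∑ i ∈ Finset.range j, (s (i + 1) - s i) * ‖g (i + 1)‖ := by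
  intro k
  -- Double induction over the grid of index pairs: the point estimate handles the edges `k = 0` and
  -- `j = 0`, and the interior combines the left and lower neighbours.
  induction k with
  | zero =>
    intro _ j hj
    have h1 := H'.norm_sub_point_le hA hxy j hj
    have h2 : ‖v 0 - u j‖ ≤ ‖v 0 - x‖ + ‖u j - x‖ := by
      rw [← norm_sub_rev x (u j)]; exact norm_sub_le_norm_sub_add_norm_sub _ _ _
    have h3 : s j ≤ √((t 0 - s j) ^ 2 + ∑ i ∈ Finset.range 0, (t (i + 1) - t i) ^ 2
        + ∑ i ∈ Finset.range j, (s (i + 1) - s i) ^ 2) := by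
      apply Real.le_sqrt_of_sq_le
      have := Finset.sum_nonneg (fun i (_ : i ∈ Finset.range j) => sq_nonneg (s (i + 1) - s i))
      simp only [H.t_zero, Finset.range_zero, Finset.sum_empty]
      linarith
    have := mul_le_mul_of_nonneg_right h3 (norm_nonneg y)
    simp only [Finset.range_zero, Finset.sum_empty] at this ⊢
    linarith
  | succ k ihk =>
    intro hk j
    induction j with
    | zero =>
      intro _
      have h1 := H.norm_sub_point_le hA hxy (k + 1) hk
      have h2 : ‖v (k + 1) - u 0‖ ≤ ‖v (k + 1) - x‖ + ‖u 0 - x‖ := by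
        rw [← norm_sub_rev x (u 0)]; exact norm_sub_le_norm_sub_add_norm_sub _ _ _
      have h3 : t (k + 1) ≤ √((t (k + 1) - s 0) ^ 2
          + ∑ i ∈ Finset.range (k + 1), (t (i + 1) - t i) ^ 2
          + ∑ i ∈ Finset.range 0, (s (i + 1) - s i) ^ 2) := by
        apply Real.le_sqrt_of_sq_le
        have := Finset.sum_nonneg
          (fun i (_ : i ∈ Finset.range (k + 1)) => sq_nonneg (t (i + 1) - t i))
        simp only [H'.t_zero, Finset.range_zero, Finset.sum_empty]
        linarith
      have := mul_le_mul_of_nonneg_right h3 (norm_nonneg y)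
      simp only [Finset.range_zero, Finset.sum_empty] at this ⊢
      linarith
    | succ j ihj =>
      intro hj
      have i1 := ihk (by omega) (j + 1) hj
      have i2 := ihj (by omega)
      obtain ⟨a, ha, ea⟩ := H.step k (by omega)
      obtain ⟨b, hb, eb⟩ := H'.step j (by omega)
      have hl : 0 < t (k + 1) - t k := sub_pos.2 (H.t_lt k (by omega))
      have hd : 0 < s (j + 1) - s j := sub_pos.2 (H'.t_lt j (by omega))
      have h2 := hA.two_step hl hd ha hb ea eb
      simp only [Finset.sum_range_succ _ k, Finset.sum_range_succ _ j] at i1 i2 ⊢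
      set l := t (k + 1) - t k with hl_def
      set d := s (j + 1) - s j with hd_def
      set P := ∑ i ∈ Finset.range k, (t (i + 1) - t i) ^ 2
      set Q := ∑ i ∈ Finset.range j, (s (i + 1) - s i) ^ 2
      have hP : 0 ≤ P := Finset.sum_nonneg fun i _ => sq_nonneg _
      have hQ : 0 ≤ Q := Finset.sum_nonneg fun i _ => sq_nonneg _
      have h3 := mul_le_mul_of_nonneg_right
        (sqrt_two_step (D := t (k + 1) - s (j + 1)) hl hd hP hQ) (norm_nonneg y)
      have e1 : t (k + 1) - s (j + 1) - l = t k - s (j + 1) := by simp [hl_def]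
      have e2 : t (k + 1) - s (j + 1) + d = t (k + 1) - s j := by simp [hd_def]
      rw [e1, e2] at h3
      have i1 := mul_le_mul_of_nonneg_left i1 hd.le
      have i2 := mul_le_mul_of_nonneg_left i2 hl.le
      have hs : 0 < l + d := by positivity
      refine le_of_mul_le_mul_left ?_ hs
      refine h2.trans ?_
      linarith

end Accretive

/-! ### Uniqueness of Euler limits and the Crandall–Liggett theorem. -/

section MildLimit

variable {B : Type*} [NormedAddCommGroup B] [NormedSpace ℝ B]

theorem sum_sub_sq_le {t : ℕ → ℝ} {N : ℕ} {e : ℝ} (h0 : t 0 = 0) (ht : ∀ k < N, t k < t (k + 1))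
    (he : ∀ k < N, t (k + 1) - t k ≤ e) :
    ∀ k ≤ N, ∑ i ∈ Finset.range k, (t (i + 1) - t i) ^ 2 ≤ e * t k := by
  intro k hk
  have h1 : ∑ i ∈ Finset.range k, (t (i + 1) - t i) = t k := by
    rw [Finset.sum_range_sub, h0, sub_zero]
  rw [← h1, Finset.mul_sum]
  refine Finset.sum_le_sum fun i hi => ?_
  have hi : i < N := by have := Finset.mem_range.1 hi; omega
  rw [sq]
  exact mul_le_mul_of_nonneg_right (he i hi) (sub_nonneg.2 (ht i hi).le)

theorem partition_le {t : ℕ → ℝ} {N : ℕ} (ht : ∀ k < N, t k < t (k + 1)) {j k : ℕ}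
    (hjk : j ≤ k) : k ≤ N → t j ≤ t k := by
  induction k, hjk using Nat.le_induction with
  | base => intro _; exact le_rfl
  | succ k _ ih => intro hk; exact (ih (by omega)).trans (ht k (by omega)).le

theorem exists_mem_Ioc_of_partition {t : ℕ → ℝ} {N : ℕ} (h0 : t 0 = 0) {s : ℝ} (hs : 0 < s)
    (hsN : s ≤ t N) : ∃ k < N, s ∈ Set.Ioc (t k) (t (k + 1)) := by
  classical
  have hex : ∃ n, s ≤ t n := ⟨N, hsN⟩
  have h1 := Nat.find_spec hex
  have h2 : Nat.find hex ≤ N := Nat.find_min' hex hsN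
  have h3 : Nat.find hex ≠ 0 := by
    intro h; rw [h, h0] at h1; linarith
  obtain ⟨k, hk⟩ := Nat.exists_eq_succ_of_ne_zero h3
  refine ⟨k, by omega, ?_, by rw [hk] at h1; exact h1⟩
  exact not_le.1 (Nat.find_min hex (by omega))

/-- `U` is the limit at time `s` of implicit Euler schemes on `[0,T]` that start at `x₀` and whose
mesh and total error tend to zero. -/
def IsEulerLimit (A : Set (B × B)) (x₀ : B) (T s : ℝ) (U : B) : Prop :=
  ∀ e > 0, ∃ (N : ℕ) (t : ℕ → ℝ) (h v : ℕ → B), IsEulerScheme A N t h v ∧ v 0 = x₀ ∧ t N ≤ T ∧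
    (∀ k < N, t (k + 1) - t k ≤ e) ∧
    ∑ i ∈ Finset.range N, (t (i + 1) - t i) * ‖h (i + 1)‖ ≤ e ∧
    ∃ k < N, s ∈ Set.Ioc (t k) (t (k + 1)) ∧ ‖U - v (k + 1)‖ < e

theorem IsEulerScheme.sum_le_sum {A : Set (B × B)} {N : ℕ} {t : ℕ → ℝ} {h v : ℕ → B}
    (H : IsEulerScheme A N t h v) {k : ℕ} (hk : k ≤ N) :
    ∑ i ∈ Finset.range k, (t (i + 1) - t i) * ‖h (i + 1)‖ ≤
      ∑ i ∈ Finset.range N, (t (i + 1) - t i) * ‖h (i + 1)‖ := by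
  refine Finset.sum_le_sum_of_subset_of_nonneg (Finset.range_subset_range.2 hk) fun i hi _ => ?_
  exact mul_nonneg (sub_nonneg.2 (H.t_lt i (Finset.mem_range.1 hi)).le) (norm_nonneg _)

/-- Limits of Euler schemes of an accretive operator are unique. -/
theorem IsEulerLimit.unique {A : Set (B × B)} (hA : IsAccretive A) {x₀ : B}
    (hx₀ : x₀ ∈ closure (Prod.fst '' A)) {T s : ℝ} {U V : B}
    (hU : IsEulerLimit A x₀ T s U) (hV : IsEulerLimit A x₀ T s V) : U = V := by
  rw [← sub_eq_zero, ← norm_le_zero_iff]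
  refine le_of_forall_pos_le_add fun r hr => ?_
  obtain ⟨_, ⟨⟨x, y⟩, hxy, rfl⟩, hx⟩ := Metric.mem_closure_iff.1 hx₀ (r / 2) (by positivity)
  simp only [dist_eq_norm] at hx
  -- The `4 * e` collects two approximation errors and two error sums. The `e ^ 2` bounds the
  -- squared gap of the two grid times, whose intervals both contain `s`, and `2 * (e * T)` bounds
  -- the squared step sizes.
  have key : ∀ e > 0, ‖U - V‖ ≤ 4 * e + 2 * ‖x₀ - x‖ + √(e ^ 2 + 2 * (e * T)) * ‖y‖ := by
    intro e he
    obtain ⟨N, t, h, v, H, hv0, htN, hm, herr, k, hk, hsk, hUk⟩ := hU e he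
    obtain ⟨N', t', h', v', H', hv0', htN', hm', herr', j, hj, hsj, hVj⟩ := hV e he
    have h1 := H.norm_sub_le_sqrt hA H' hxy (k + 1) hk (j + 1) hj
    rw [hv0, hv0'] at h1
    have h2 := H.sum_le_sum (k := k + 1) hk
    have h3 := H'.sum_le_sum (k := j + 1) hj
    have h4 := sum_sub_sq_le H.t_zero H.t_lt hm (k + 1) hk
    have h5 := sum_sub_sq_le H'.t_zero H'.t_lt hm' (j + 1) hj
    have h6 : e * t (k + 1) ≤ e * T :=
      mul_le_mul_of_nonneg_left ((partition_le H.t_lt (j := k + 1) hk le_rfl).trans htN) he.le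
    have h7 : e * t' (j + 1) ≤ e * T :=
      mul_le_mul_of_nonneg_left ((partition_le H'.t_lt (j := j + 1) hj le_rfl).trans htN') he.le
    have h8 : (t (k + 1) - t' (j + 1)) ^ 2 ≤ e ^ 2 := by
      have a1 := hm k hk
      have a2 := hm' j hj
      have := hsk.1; have := hsk.2; have := hsj.1; have := hsj.2
      apply sq_le_sq'  <;> linarith
    have h9 : √((t (k + 1) - t' (j + 1)) ^ 2
        + ∑ i ∈ Finset.range (k + 1), (t (i + 1) - t i) ^ 2
        + ∑ i ∈ Finset.range (j + 1), (t' (i + 1) - t' i) ^ 2) * ‖y‖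
        ≤ √(e ^ 2 + 2 * (e * T)) * ‖y‖ :=
      mul_le_mul_of_nonneg_right (Real.sqrt_le_sqrt (by linarith)) (norm_nonneg _)
    have h10 : ‖U - V‖ ≤ ‖U - v (k + 1)‖ + ‖v (k + 1) - v' (j + 1)‖ + ‖V - v' (j + 1)‖ := by
      rw [norm_sub_rev V]
      have : U - V = (U - v (k + 1)) + (v (k + 1) - v' (j + 1)) + (v' (j + 1) - V) := by abel
      rw [this]; exact norm_add₃_le
    linarith
  have hlim : Tendsto (fun e : ℝ => 4 * e + 2 * ‖x₀ - x‖ + √(e ^ 2 + 2 * (e * T)) * ‖y‖)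
      (𝓝[>] 0) (𝓝 (4 * 0 + 2 * ‖x₀ - x‖ + √(0 ^ 2 + 2 * (0 * T)) * ‖y‖)) := by
    refine tendsto_nhdsWithin_of_tendsto_nhds (Continuous.tendsto ?_ 0)
    fun_prop
  have h := ge_of_tendsto hlim (eventually_mem_nhdsWithin.mono fun e he => key e he)
  simp at h
  linarith

/-- The value at time `s` of the Euler approximation of step size `1 / (n + 1)`, for a resolvent
`R`. -/
noncomputable def eulerApprox (R : ℝ → B → B) (x₀ : B) (n : ℕ) (s : ℝ) : B :=
  (R (1 / ((n : ℝ) + 1)))^[⌈s * (n + 1)⌉₊] x₀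

theorem isEulerScheme_iterate {A : Set (B × B)} {K : Set B} {R : ℝ → B → B}
    (hR : ∀ l > 0, ∀ g ∈ K, R l g ∈ K ∧ ∃ y, (R l g, y) ∈ A ∧ R l g + l • y = g)
    {x₀ : B} (hx₀ : x₀ ∈ K) {l : ℝ} (hl : 0 < l) (N : ℕ) :
    IsEulerScheme A N (fun k => k * l) 0 (fun k => (R l)^[k] x₀) := by
  have hK : ∀ k, (R l)^[k] x₀ ∈ K := by
    intro k
    induction k with
    | zero => exact hx₀
    | succ k ih => rw [Function.iterate_succ_apply']; exact (hR l hl _ ih).1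
  refine ⟨by simp, fun k _ => ?_, fun k _ => ?_⟩
  · push_cast; linarith
  · obtain ⟨y, hy, e⟩ := (hR l hl _ (hK k)).2
    refine ⟨y, ?_, ?_⟩
    · simp only [Function.iterate_succ_apply']; exact hy
    · simp only [Function.iterate_succ_apply', Pi.zero_apply, smul_zero, add_zero]
      rw [← e]; congr 2; push_cast; ring

/-- With `s = r` this yields the Cauchy property in the step size; with `m = n` it yields continuity
of the limit in time. Rounding a time up to the grid adds at most `e ≤ 1`, which explains `T + 1`.
-/
theorem norm_eulerApprox_sub_le {A : Set (B × B)} (hA : IsAccretive A) {K : Set B}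
    {R : ℝ → B → B}
    (hR : ∀ l > 0, ∀ g ∈ K, R l g ∈ K ∧ ∃ y, (R l g, y) ∈ A ∧ R l g + l • y = g)
    {x₀ : B} (hx₀ : x₀ ∈ K) {x y : B} (hxy : (x, y) ∈ A) {m n : ℕ} {e T s r : ℝ}
    (hm : 1 / ((m : ℝ) + 1) ≤ e) (hn : 1 / ((n : ℝ) + 1) ≤ e) (he : e ≤ 1)
    (hs : s ∈ Set.Icc 0 T) (hr : r ∈ Set.Icc 0 T) :
    ‖eulerApprox R x₀ m s - eulerApprox R x₀ n r‖ ≤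
      2 * ‖x₀ - x‖ + √((|s - r| + e) ^ 2 + 2 * (e * (T + 1))) * ‖y‖ := by
  have hm0 : (0 : ℝ) < 1 / ((m : ℝ) + 1) := by positivity
  have hn0 : (0 : ℝ) < 1 / ((n : ℝ) + 1) := by positivity
  have ceil_bound : ∀ (i : ℕ) (z : ℝ), 0 ≤ z → 1 / ((i : ℝ) + 1) ≤ e →
      z ≤ ⌈z * (i + 1)⌉₊ * (1 / ((i : ℝ) + 1)) ∧
      ⌈z * (i + 1)⌉₊ * (1 / ((i : ℝ) + 1)) ≤ z + e := by
    intro i z hz hi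
    have hp : (0 : ℝ) < (i : ℝ) + 1 := by positivity
    constructor
    · rw [mul_one_div, le_div_iff₀ hp]; exact Nat.le_ceil _
    · have := (Nat.ceil_lt_add_one (a := z * ((i : ℝ) + 1)) (by positivity)).le
      calc _ ≤ (z * ((i : ℝ) + 1) + 1) * (1 / ((i : ℝ) + 1)) := by gcongr
        _ = z + 1 / ((i : ℝ) + 1) := by field_simp
        _ ≤ _ := by linarith
  obtain ⟨a1, a2⟩ := ceil_bound m s hs.1 hm
  obtain ⟨b1, b2⟩ := ceil_bound n r hr.1 hn
  have H := isEulerScheme_iterate hR hx₀ hm0 ⌈s * (m + 1)⌉₊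
  have H' := isEulerScheme_iterate hR hx₀ hn0 ⌈r * (n + 1)⌉₊
  have h1 := H.norm_sub_le_sqrt hA H' hxy _ le_rfl _ le_rfl
  have h4 := sum_sub_sq_le (e := e) H.t_zero H.t_lt
    (fun k _ => by push_cast; linarith) _ le_rfl
  have h5 := sum_sub_sq_le (e := e) H'.t_zero H'.t_lt
    (fun k _ => by push_cast; linarith) _ le_rfl
  have he0 : 0 ≤ e := hm0.le.trans hm
  have h6 := mul_le_mul_of_nonneg_left (a2.trans (add_le_add hs.2 he)) he0
  have h7 := mul_le_mul_of_nonneg_left (b2.trans (add_le_add hr.2 he)) he0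
  simp only [Function.iterate_zero, id_eq, Pi.zero_apply, norm_zero, mul_zero,
    Finset.sum_const_zero, add_zero] at h1
  refine h1.trans ?_
  rw [two_mul]
  refine add_le_add le_rfl (mul_le_mul_of_nonneg_right (Real.sqrt_le_sqrt ?_) (norm_nonneg y))
  have h8 : (⌈s * (m + 1)⌉₊ * (1 / ((m : ℝ) + 1)) - ⌈r * (n + 1)⌉₊ * (1 / ((n : ℝ) + 1))) ^ 2
      ≤ (|s - r| + e) ^ 2 := by
    have := le_abs_self (s - r)
    have := neg_abs_le (s - r)
    apply sq_le_sq' <;> linarith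
  linarith

/-- The Crandall–Liggett theorem, for an accretive operator with the range condition on `K`. -/
theorem exists_tendstoUniformlyOn_eulerApprox [CompleteSpace B] {A : Set (B × B)}
    (hA : IsAccretive A) {K : Set B} {R : ℝ → B → B}
    (hR : ∀ l > 0, ∀ g ∈ K, R l g ∈ K ∧ ∃ y, (R l g, y) ∈ A ∧ R l g + l • y = g)
    {x₀ : B} (hx₀ : x₀ ∈ K) (hx₀' : x₀ ∈ closure (Prod.fst '' A)) :
    ∃ u : ℝ → B, (∀ T, TendstoUniformlyOn (eulerApprox R x₀) u atTop (Set.Icc 0 T)) ∧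
      ∀ T, ContinuousOn u (Set.Icc 0 T) := by
  have hx : ∀ r > 0, ∃ x y, (x, y) ∈ A ∧ 2 * ‖x₀ - x‖ < r := by
    intro r hr
    obtain ⟨_, ⟨⟨x, y⟩, hxy, rfl⟩, hx⟩ := Metric.mem_closure_iff.1 hx₀' (r / 2) (by positivity)
    simp only [dist_eq_norm] at hx
    exact ⟨x, y, hxy, by linarith⟩
  have hlim : ∀ (d T Y : ℝ), Tendsto (fun n : ℕ => √((|d| + 1 / ((n : ℝ) + 1)) ^ 2
      + 2 * (1 / ((n : ℝ) + 1) * (T + 1))) * Y) atTop (𝓝 (|d| * Y)) := by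
    intro d T Y
    have h1 : Tendsto (fun e : ℝ => √((|d| + e) ^ 2 + 2 * (e * (T + 1))) * Y) (𝓝 0)
        (𝓝 (√((|d| + 0) ^ 2 + 2 * (0 * (T + 1))) * Y)) := by
      refine Continuous.tendsto ?_ 0
      fun_prop
    have h2 : √((|d| + 0) ^ 2 + 2 * (0 * (T + 1))) = |d| := by
      simp [Real.sqrt_sq_eq_abs]
    rw [h2] at h1
    exact h1.comp tendsto_one_div_add_atTop_nhds_zero_nat
  have hle1 : ∀ n : ℕ, 1 / ((n : ℝ) + 1) ≤ 1 := by
    intro n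
    rw [div_le_one (by positivity)]
    have : (0 : ℝ) ≤ n := n.cast_nonneg
    linarith
  have hanti : ∀ {m n : ℕ}, m ≤ n → 1 / ((n : ℝ) + 1) ≤ 1 / ((m : ℝ) + 1) :=
    fun h => Nat.one_div_le_one_div h
  have hC : ∀ T, UniformCauchySeqOn (eulerApprox R x₀) atTop (Set.Icc 0 T) := by
    intro T
    rw [Metric.uniformCauchySeqOn_iff]
    intro r hr
    obtain ⟨x, y, hxy, hx⟩ := hx (r / 2) (by positivity)
    have h := (hlim 0 T ‖y‖).eventually (gt_mem_nhds (show |0| * ‖y‖ < r / 2 by simp; positivity))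
    obtain ⟨N, hN⟩ := h.exists
    refine ⟨N, fun m hm n hn s hs => ?_⟩
    have := norm_eulerApprox_sub_le hA hR hx₀ hxy (hanti hm) (hanti hn) (hle1 N) hs hs
    rw [sub_self] at this
    rw [dist_eq_norm]
    linarith
  have hpt : ∀ s, ∃ z, 0 ≤ s → Tendsto (fun n => eulerApprox R x₀ n s) atTop (𝓝 z) := by
    intro s
    by_cases hs : 0 ≤ s
    · obtain ⟨z, hz⟩ := cauchySeq_tendsto_of_complete ((hC s).cauchySeq (x := s) ⟨hs, le_rfl⟩)
      exact ⟨z, fun _ => hz⟩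
    · exact ⟨0, fun h => absurd h hs⟩
  choose u hu using hpt
  have hU : ∀ T, TendstoUniformlyOn (eulerApprox R x₀) u atTop (Set.Icc 0 T) := fun T =>
    (hC T).tendstoUniformlyOn_of_tendsto fun s hs => hu s hs.1
  refine ⟨u, hU, fun T => ?_⟩
  rw [Metric.continuousOn_iff]
  intro s hs r hr
  obtain ⟨x, y, hxy, hx⟩ := hx (r / 2) (by positivity)
  -- In the limit `n → ∞` only `|a - s| * ‖y‖` survives of the root term; the `+ 1` covers `y = 0`.
  refine ⟨r / (2 * (‖y‖ + 1)), by positivity, fun a ha hd => ?_⟩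
  have h1 : ‖u a - u s‖ ≤ 2 * ‖x₀ - x‖ + |a - s| * ‖y‖ := by
    refine le_of_tendsto_of_tendsto (((hu a ha.1).sub (hu s hs.1)).norm)
      ((hlim (a - s) T ‖y‖).const_add _) (Eventually.of_forall fun n => ?_)
    exact norm_eulerApprox_sub_le hA hR hx₀ hxy le_rfl le_rfl (hle1 n) ha hs
  rw [Real.dist_eq, lt_div_iff₀ (by positivity)] at hd
  rw [dist_eq_norm]
  nlinarith [abs_nonneg (a - s)]

end MildLimit

/-! ### The weighted space `ℓ^p(X, μ)` as a copy of an unweighted sequence space. -/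

namespace WeightedGraph

variable {X : Type*}

section Ellp

variable (G : WeightedGraph X) {p : ℝ}

theorem norm_mul_rpow (hp : 0 < p) (u : X → ℝ) (x : X) :
    ‖u x * G.μ x ^ (1 / p)‖ ^ (ENNReal.ofReal p).toReal = |u x| ^ p * G.μ x := by
  have h := (G.μ_pos x).le
  rw [ENNReal.toReal_ofReal hp.le, norm_mul, Real.norm_eq_abs,
    Real.norm_of_nonneg (Real.rpow_nonneg h _), Real.mul_rpow (abs_nonneg _)
    (Real.rpow_nonneg h _), ← Real.rpow_mul h, one_div_mul_cancel hp.ne', Real.rpow_one]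

theorem memℓp_iff (hp : 0 < p) (u : X → ℝ) :
    Memℓp (fun x => u x * G.μ x ^ (1 / p)) (ENNReal.ofReal p) ↔ G.MemEllp p u := by
  rw [memℓp_gen_iff (by rwa [ENNReal.toReal_ofReal hp.le]), MemEllp]
  simp only [G.norm_mul_rpow hp]

open Classical in
/-- The isometry of `ℓ^p(X, μ)` onto the unweighted sequence space (zero off `ℓ^p(X, μ)`). -/
noncomputable def toLp (p : ℝ) (u : X → ℝ) : lp (fun _ : X => ℝ) (ENNReal.ofReal p) :=
  if h : Memℓp (fun x => u x * G.μ x ^ (1 / p)) (ENNReal.ofReal p) then ⟨_, h⟩ else 0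

variable {G}

theorem MemEllp.toLp_apply (hp : 0 < p) {u : X → ℝ} (hu : G.MemEllp p u) (x : X) :
    G.toLp p u x = u x * G.μ x ^ (1 / p) := by
  rw [toLp, dif_pos ((G.memℓp_iff hp u).2 hu)]

theorem MemEllp.norm_toLp (hp : 0 < p) {u : X → ℝ} (hu : G.MemEllp p u) :
    ‖G.toLp p u‖ = G.ellpNorm p u := by
  rw [lp.norm_eq_tsum_rpow (by rwa [ENNReal.toReal_ofReal hp.le]), ellpNorm]
  simp only [hu.toLp_apply hp, G.norm_mul_rpow hp]
  rw [ENNReal.toReal_ofReal hp.le]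

theorem MemEllp.add (hp : 0 < p) {u v : X → ℝ} (hu : G.MemEllp p u) (hv : G.MemEllp p v) :
    G.MemEllp p (u + v) := by
  rw [← G.memℓp_iff hp] at *
  have := hu.add hv
  refine cast ?_ this
  congr 1; ext x; simp [add_mul]

theorem MemEllp.smul (hp : 0 < p) {u : X → ℝ} (c : ℝ) (hu : G.MemEllp p u) :
    G.MemEllp p (c • u) := by
  rw [← G.memℓp_iff hp] at *
  have := hu.const_smul c
  refine cast ?_ this
  congr 1; ext x; simp [mul_assoc]

theorem MemEllp.sub (hp : 0 < p) {u v : X → ℝ} (hu : G.MemEllp p u) (hv : G.MemEllp p v) :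
    G.MemEllp p (u - v) := by
  have := hu.add hp (hv.smul hp (-1))
  rwa [neg_one_smul, ← sub_eq_add_neg] at this

theorem memEllp_of_support_subset (hp : 0 < p) {u : X → ℝ} {E : Finset X}
    (h : Function.support u ⊆ E) : G.MemEllp p u := by
  refine summable_of_ne_finset_zero (s := E) fun x hx => ?_
  have : u x = 0 := by
    by_contra h0; exact hx (h h0)
  rw [this, abs_zero, Real.zero_rpow hp.ne', zero_mul]

theorem MemEllp.toLp_add (hp : 0 < p) {u v : X → ℝ} (hu : G.MemEllp p u) (hv : G.MemEllp p v) :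
    G.toLp p (u + v) = G.toLp p u + G.toLp p v := by
  ext x
  rw [lp.coeFn_add, Pi.add_apply, (hu.add hp hv).toLp_apply hp, hu.toLp_apply hp,
    hv.toLp_apply hp, Pi.add_apply, add_mul]

theorem MemEllp.toLp_smul (hp : 0 < p) {u : X → ℝ} (c : ℝ) (hu : G.MemEllp p u) :
    G.toLp p (c • u) = c • G.toLp p u := by
  ext x
  rw [lp.coeFn_smul, Pi.smul_apply, (hu.smul hp c).toLp_apply hp, hu.toLp_apply hp,
    Pi.smul_apply, smul_eq_mul, smul_eq_mul, mul_assoc]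

theorem MemEllp.toLp_sub (hp : 0 < p) {u v : X → ℝ} (hu : G.MemEllp p u) (hv : G.MemEllp p v) :
    G.toLp p (u - v) = G.toLp p u - G.toLp p v := by
  rw [eq_sub_iff_add_eq, ← (hu.sub hp hv).toLp_add hp hv, sub_add_cancel]

theorem MemEllp.norm_toLp_sub (hp : 0 < p) {u v : X → ℝ} (hu : G.MemEllp p u)
    (hv : G.MemEllp p v) : ‖G.toLp p u - G.toLp p v‖ = G.ellpNorm p (u - v) := by
  rw [← hu.toLp_sub hp hv, (hu.sub hp hv).norm_toLp hp]

theorem MemEllp.toLp_inj (hp : 0 < p) {u v : X → ℝ} (hu : G.MemEllp p u)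
    (hv : G.MemEllp p v) (h : G.toLp p u = G.toLp p v) : u = v := by
  ext x
  have := congrArg (fun b : lp (fun _ : X => ℝ) (ENNReal.ofReal p) => b x) h
  simp only [hu.toLp_apply hp, hv.toLp_apply hp] at this
  exact mul_right_cancel₀ (Real.rpow_pos_of_pos (G.μ_pos x) _).ne' this

-- Surjectivity lets limits obtained by completeness of `lp` be read as functions on the nodes.
variable (G) in
theorem exists_toLp_eq (hp : 0 < p) (b : lp (fun _ : X => ℝ) (ENNReal.ofReal p)) :
    ∃ u, G.MemEllp p u ∧ G.toLp p u = b := by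
  have h : ∀ x, b x * G.μ x ^ (-(1 / p)) * G.μ x ^ (1 / p) = b x := fun x => by
    rw [mul_assoc, ← Real.rpow_add (G.μ_pos x), neg_add_cancel, Real.rpow_zero, mul_one]
  have hm : G.MemEllp p (fun x => b x * G.μ x ^ (-(1 / p))) := by
    rw [← G.memℓp_iff hp]
    simp only [h]
    exact lp.memℓp b
  refine ⟨_, hm, ?_⟩
  ext x
  rw [hm.toLp_apply hp, h]

theorem MemEllp.tendsto_toLp_iff [Fact (1 ≤ ENNReal.ofReal p)] (hp : 0 < p) {ι : Type*} {l : Filter ι} {u : ι → X → ℝ}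
    {v : X → ℝ} (hu : ∀ i, G.MemEllp p (u i)) (hv : G.MemEllp p v) :
    Tendsto (fun i => G.toLp p (u i)) l (𝓝 (G.toLp p v)) ↔
      Tendsto (fun i => G.ellpNorm p (u i - v)) l (𝓝 0) := by
  rw [tendsto_iff_norm_sub_tendsto_zero]
  simp only [(hu _).norm_toLp_sub hp hv]

theorem tendsto_apply_of_tendsto_toLp [Fact (1 ≤ ENNReal.ofReal p)] (hp : 1 ≤ p) {ι : Type*} {l : Filter ι} {u : ι → X → ℝ}
    {v : X → ℝ} (hu : ∀ i, G.MemEllp p (u i)) (hv : G.MemEllp p v)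
    (h : Tendsto (fun i => G.toLp p (u i)) l (𝓝 (G.toLp p v))) (x : X) :
    Tendsto (fun i => u i x) l (𝓝 (v x)) := by
  have hp0 : 0 < p := by linarith
  have h1 := ((continuous_apply x).tendsto _).comp
    ((lp.uniformContinuous_coe (p := ENNReal.ofReal p)).continuous.tendsto (G.toLp p v))
  have h2 := (h1.comp h).mul_const (G.μ x ^ (1 / p))⁻¹
  have h0 : G.μ x ^ (1 / p) ≠ 0 := (Real.rpow_pos_of_pos (G.μ_pos x) _).ne'
  have h3 : Tendsto (fun i => G.toLp p (u i) x * (G.μ x ^ (1 / p))⁻¹) l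
      (𝓝 (G.toLp p v x * (G.μ x ^ (1 / p))⁻¹)) := h2
  simpa only [hv.toLp_apply hp0, (hu _).toLp_apply hp0, mul_inv_cancel_right₀ h0] using h3

/-- Dominated convergence in `ℓ^p(X, μ)`. -/
theorem tendsto_ellpNorm_zero_of_dominated (hp : 0 < p) {v : ℕ → X → ℝ} {b : X → ℝ}
    (hb : G.MemEllp p b) (h : ∀ n x, |v n x| ≤ |b x|)
    (hv : ∀ x, Tendsto (fun n => v n x) atTop (𝓝 0)) :
    Tendsto (fun n => G.ellpNorm p (v n)) atTop (𝓝 0) := by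
  have h1 : Tendsto (fun n => ∑' x, |v n x| ^ p * G.μ x) atTop (𝓝 (∑' _ : X, (0 : ℝ))) := by
    refine tendsto_tsum_of_dominated_convergence hb (fun x => ?_)
      (Eventually.of_forall fun n x => ?_)
    · have := ((hv x).abs.rpow_const (p := p) (Or.inr hp.le)).mul_const (G.μ x)
      simpa [Real.zero_rpow hp.ne'] using this
    · have := G.μ_pos x
      rw [Real.norm_of_nonneg (by positivity)]
      exact mul_le_mul_of_nonneg_right (Real.rpow_le_rpow (abs_nonneg _) (h n x) hp.le) this.le
  rw [tsum_zero] at h1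
  have := h1.rpow_const (p := 1 / p) (Or.inr (by positivity))
  rwa [Real.zero_rpow (by positivity)] at this

end Ellp

/-! ### The Laplacian and its Dirichlet restrictions. -/

section Laplacian

variable (G : WeightedGraph X)

theorem lap_eq {u : X → ℝ} {x : X} (hu : Summable fun y => G.w x y * u y) :
    G.lap u x = ((∑' y, G.w x y + G.κ x) * u x - ∑' y, G.w x y * u y) / G.μ x := by
  have h : ∑' y, G.w x y * (u x - u y) = (∑' y, G.w x y) * u x - ∑' y, G.w x y * u y := by
    rw [← tsum_mul_right, ← ((G.w_summable x).mul_right (u x)).tsum_sub hu]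
    exact tsum_congr fun y => by ring
  rw [lap, h]
  field_simp
  ring

/-- The extra killing term is exactly the weight missing from the row sum over `E`, so the Dirichlet
operator is the full operator acting on the extension by zero. -/
theorem opADir_of_mem (f : ℝ → ℝ) (E : Finset X) (u : X → ℝ) {x : X} (hx : x ∈ E) :
    G.opADir f (E : Set X) u x = G.opA f ((E : Set X).indicator u) x := by
  classical
  have hx' : x ∈ (E : Set X) := hx
  have hs : Summable fun y => G.w x y * (E : Set X).indicator u y :=
    summable_of_ne_finset_zero (s := E) fun y hy => by
      rw [Set.indicator_of_notMem (by simpa using hy), mul_zero]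
  rw [opADir, dif_pos hx', opA, opA, G.lap_eq hs, lap_eq _ (Summable.of_finite),
    Set.indicator_of_mem hx']
  have h1 : ∑' y : (E : Set X), (G.dirichlet E).w ⟨x, hx'⟩ y * u y
      = ∑' y, G.w x y * (E : Set X).indicator u y := by
    have := tsum_subtype (E : Set X) (fun y => G.w x y * u y)
    refine Eq.trans this (tsum_congr fun y => ?_)
    by_cases hy : y ∈ (E : Set X) <;> simp [Set.indicator, hy]
  have h2 := (G.w_summable x).tsum_subtype_add_tsum_subtype_compl (E : Set X)
  rw [h1, ← h2]
  simp only [dirichlet]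
  ring_nf

theorem opADir_of_notMem (f : ℝ → ℝ) (Y : Set X) (u : X → ℝ) {x : X} (hx : x ∉ Y) :
    G.opADir f Y u x = 0 := by
  rw [opADir, dif_neg hx]

theorem support_opADir_subset (f : ℝ → ℝ) (Y : Set X) (u : X → ℝ) :
    Function.support (G.opADir f Y u) ⊆ Y := by
  intro x hx
  by_contra h
  exact hx (G.opADir_of_notMem f Y u h)

end Laplacian

/-! ### Accretivity of the finite Dirichlet operators and of `𝒜` on `Ω_p`. -/

section Accretive

variable (G : WeightedGraph X) {p : ℝ}

/-- `ℓ^p`-contraction for subsolutions of the resolvent equation of a finite Dirichlet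
Laplacian. -/
theorem sum_rpow_le_of_subsolution (hp : 1 ≤ p) (E : Finset X) {l : ℝ} (hl : 0 ≤ l)
    {a b : X → ℝ} (ha : ∀ x, 0 ≤ a x) (hb : ∀ x, 0 ≤ b x)
    (h : ∀ x ∈ E, a x * G.μ x + l * ∑ y ∈ E, G.w x y * (a x - a y) ≤ b x * G.μ x) :
    ∑ x ∈ E, a x ^ p * G.μ x ≤ ∑ x ∈ E, b x ^ p * G.μ x := by
  have hp0 : 0 < p := by linarith
  have hmul : ∀ x, a x * a x ^ (p - 1) = a x ^ p := by
    intro x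
    rcases (ha x).eq_or_lt with h0 | h0
    · rw [← h0, zero_mul, Real.zero_rpow hp0.ne']
    · nth_rewrite 1 [← Real.rpow_one (a x)]
      rw [← Real.rpow_add h0]; ring_nf
  -- Symmetrizing in `x, y` leaves terms `w(x,y) (a x - a y) (a x ^ (p-1) - a y ^ (p-1))`,
  -- nonnegative by monotonicity of the power.
  have hsym : 0 ≤ ∑ x ∈ E, (∑ y ∈ E, G.w x y * (a x - a y)) * a x ^ (p - 1) := by
    have e1 : ∑ x ∈ E, (∑ y ∈ E, G.w x y * (a x - a y)) * a x ^ (p - 1)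
        = ∑ x ∈ E, ∑ y ∈ E, G.w x y * (a x - a y) * a x ^ (p - 1) := by
      simp only [Finset.sum_mul]
    have e2 : ∑ x ∈ E, ∑ y ∈ E, G.w x y * (a x - a y) * a x ^ (p - 1)
        = ∑ x ∈ E, ∑ y ∈ E, G.w x y * (a y - a x) * a y ^ (p - 1) := by
      rw [Finset.sum_comm]
      refine Finset.sum_congr rfl fun x _ => Finset.sum_congr rfl fun y _ => ?_
      rw [G.w_symm]
    have e3 : 0 ≤ ∑ x ∈ E, ∑ y ∈ E, (G.w x y * (a x - a y) * a x ^ (p - 1)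
        + G.w x y * (a y - a x) * a y ^ (p - 1)) := by
      refine Finset.sum_nonneg fun x _ => Finset.sum_nonneg fun y _ => ?_
      have : 0 ≤ (a x - a y) * (a x ^ (p - 1) - a y ^ (p - 1)) := by
        rcases le_total (a x) (a y) with hxy | hxy
        · have := Real.rpow_le_rpow (ha x) hxy (show 0 ≤ p - 1 by linarith)
          exact mul_nonneg_of_nonpos_of_nonpos (by linarith) (by linarith)
        · have := Real.rpow_le_rpow (ha y) hxy (show 0 ≤ p - 1 by linarith)
          exact mul_nonneg (by linarith) (by linarith)
      have := mul_nonneg (G.w_nonneg x y) this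
      linarith
    simp only [Finset.sum_add_distrib] at e3
    rw [e1]
    linarith
  have hyoung : ∀ x, b x * a x ^ (p - 1) ≤ 1 / p * b x ^ p + (1 - 1 / p) * a x ^ p := by
    intro x
    have := Real.geom_mean_le_arith_mean2_weighted (w₁ := 1 / p) (w₂ := 1 - 1 / p)
      (by positivity) (by rw [sub_nonneg, div_le_one hp0]; exact hp)
      (Real.rpow_nonneg (hb x) p) (Real.rpow_nonneg (ha x) p) (by ring)
    rw [← Real.rpow_mul (hb x), ← Real.rpow_mul (ha x), mul_one_div_cancel hp0.ne',
      Real.rpow_one] at this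
    have e : p * (1 - 1 / p) = p - 1 := by field_simp
    rwa [e] at this
  -- The inequality is tested with `a ^ (p - 1)`, and Young's inequality splits the right-hand side.
  have h1 : ∑ x ∈ E, a x ^ p * G.μ x
      + l * ∑ x ∈ E, (∑ y ∈ E, G.w x y * (a x - a y)) * a x ^ (p - 1)
      ≤ 1 / p * ∑ x ∈ E, b x ^ p * G.μ x + (1 - 1 / p) * ∑ x ∈ E, a x ^ p * G.μ x := by
    simp only [Finset.mul_sum, ← Finset.sum_add_distrib]
    refine Finset.sum_le_sum fun x hx => ?_
    have e1 := mul_le_mul_of_nonneg_right (h x hx) (Real.rpow_nonneg (ha x) (p - 1))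
    have e2 := mul_le_mul_of_nonneg_right (hyoung x) (G.μ_pos x).le
    have e3 := hmul x
    have e4 : a x ^ p * G.μ x = a x * G.μ x * a x ^ (p - 1) := by rw [← e3]; ring
    rw [add_mul, ← e4] at e1
    linarith
  have h2 := mul_nonneg hl hsym
  have h3 : 1 / p * ∑ x ∈ E, a x ^ p * G.μ x ≤ 1 / p * ∑ x ∈ E, b x ^ p * G.μ x := by linarith
  exact le_of_mul_le_mul_left h3 (by positivity)

theorem tsum_indicator_weight (E : Finset X) (u : X → ℝ) (hu : Function.support u ⊆ E) (x : X) :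
    ∑' y, G.w x y * u y = ∑ y ∈ E, G.w x y * u y :=
  tsum_eq_sum fun y hy => by
    rw [show u y = 0 by by_contra h0; exact hy (hu h0), mul_zero]

theorem sum_weight_le (E : Finset X) (x : X) : ∑ y ∈ E, G.w x y ≤ ∑' y, G.w x y :=
  (G.w_summable x).sum_le_tsum E fun y _ => G.w_nonneg x y

/-- The finite Dirichlet operators are accretive in `ℓ^p`. -/
theorem ellpNorm_sub_le_of_support (hp : 1 ≤ p) {f : ℝ → ℝ} (hf : Antitone f) (E : Finset X)
    {u v : X → ℝ} (hu : Function.support u ⊆ E) (hv : Function.support v ⊆ E) {l : ℝ}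
    (hl : 0 ≤ l) :
    G.ellpNorm p (u - v) ≤
      G.ellpNorm p (u - v + l • (G.opADir f (E : Set X) u - G.opADir f (E : Set X) v)) := by
  have hp0 : 0 < p := by linarith
  set b : X → ℝ := u - v + l • (G.opADir f (E : Set X) u - G.opADir f (E : Set X) v)
  have hz : ∀ w : X → ℝ, Function.support w ⊆ E → ∀ x ∉ E, w x = 0 := by
    intro w hw x hx; by_contra h0; exact hx (hw h0)
  have e1 : ∑' x, |(u - v) x| ^ p * G.μ x = ∑ x ∈ E, |(u - v) x| ^ p * G.μ x :=
    tsum_eq_sum fun x hx => by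
      rw [Pi.sub_apply, hz u hu x hx, hz v hv x hx, sub_zero, abs_zero, Real.zero_rpow hp0.ne',
        zero_mul]
  have e2 : ∑' x, |b x| ^ p * G.μ x = ∑ x ∈ E, |b x| ^ p * G.μ x :=
    tsum_eq_sum fun x hx => by
      have : b x = 0 := by
        simp [b, hz u hu x hx, hz v hv x hx, G.opADir_of_notMem f (E : Set X) _ (x := x) hx]
      rw [this, abs_zero, Real.zero_rpow hp0.ne', zero_mul]
  rw [ellpNorm, ellpNorm, e1, e2]
  refine Real.rpow_le_rpow (Finset.sum_nonneg fun x _ => by have := G.μ_pos x; positivity) ?_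
    (by positivity)
  refine G.sum_rpow_le_of_subsolution hp E hl (fun x => abs_nonneg _) (fun x => abs_nonneg _) ?_
  intro x hx
  have hsum : ∀ w : X → ℝ, Function.support w ⊆ E → Summable fun y => G.w x y * w y :=
    fun w hw => summable_of_ne_finset_zero (s := E) fun y hy => by rw [hz w hw y hy, mul_zero]
  have hind : ∀ w : X → ℝ, Function.support w ⊆ E → (E : Set X).indicator w = w :=
    fun w hw => Set.indicator_eq_self.2 hw
  have hμ := G.μ_pos x
  have hbx : b x * G.μ x = (u x - v x) * G.μ x + l * ((f (v x) - f (u x)) * G.μ x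
      + (∑' y, G.w x y + G.κ x) * (u x - v x) - ∑ y ∈ E, G.w x y * (u y - v y)) := by
    have : ∑ y ∈ E, G.w x y * (u y - v y)
        = ∑ y ∈ E, G.w x y * u y - ∑ y ∈ E, G.w x y * v y := by
      rw [← Finset.sum_sub_distrib]; exact Finset.sum_congr rfl fun y _ => by ring
    rw [this]
    simp only [b, Pi.add_apply, Pi.sub_apply, Pi.smul_apply, smul_eq_mul,
      G.opADir_of_mem f E _ hx, hind u hu, hind v hv, opA, G.lap_eq (hsum u hu),
      G.lap_eq (hsum v hv), G.tsum_indicator_weight E u hu, G.tsum_indicator_weight E v hv]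
    field_simp
    ring
  have hdeg := G.sum_weight_le E x
  have hκ := G.κ_nonneg x
  set W := ∑' y, G.w x y
  have hW0 : 0 ≤ W := tsum_nonneg fun y => G.w_nonneg x y
  have hS : |∑ y ∈ E, G.w x y * (u y - v y)| ≤ ∑ y ∈ E, G.w x y * |u y - v y| := by
    refine (Finset.abs_sum_le_sum_abs _ _).trans_eq (Finset.sum_congr rfl fun y _ => ?_)
    rw [abs_mul, abs_of_nonneg (G.w_nonneg x y)]
  have hsub : ∑ y ∈ E, G.w x y * (|(u - v) x| - |(u - v) y|)
      = (∑ y ∈ E, G.w x y) * |u x - v x| - ∑ y ∈ E, G.w x y * |u y - v y| := by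
    rw [Finset.sum_mul, ← Finset.sum_sub_distrib]
    exact Finset.sum_congr rfl fun y _ => by simp only [Pi.sub_apply]; ring
  rw [hsub, Pi.sub_apply, ← abs_of_pos hμ, ← abs_mul (b x), abs_of_pos hμ, hbx]
  -- Pointwise Kato inequality: multiplied by the sign of `d`, the absorption difference `φ` is
  -- nonnegative and can be dropped. Hence `|u - v|` is a subsolution with right-hand side `|b|`.
  have key : ∀ d φ : ℝ, 0 ≤ d * φ → ∀ S D D' : ℝ, 0 ≤ D' → D' ≤ D → ∀ T, |S| ≤ T →
      |d| * G.μ x + l * (D' * |d| - T) ≤ |d * G.μ x + l * (φ * G.μ x + D * d - S)| := by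
    intro d φ hdφ S D D' hD' hDD T hT
    have hS := abs_le.1 hT
    have h1 : D' * |d| ≤ D * |d| := mul_le_mul_of_nonneg_right hDD (abs_nonneg d)
    rcases lt_trichotomy d 0 with hd | hd | hd
    · have hφ : φ ≤ 0 := by by_contra hc; nlinarith
      rw [abs_of_neg hd] at *
      refine le_trans ?_ (neg_le_abs _)
      have : l * (D' * -d - T) ≤ l * -(φ * G.μ x + D * d - S) :=
        mul_le_mul_of_nonneg_left (by nlinarith) hl
      linarith
    · subst hd
      simp only [abs_zero, zero_mul, mul_zero, zero_sub, zero_add]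
      exact (mul_nonpos_of_nonneg_of_nonpos hl (by linarith [abs_nonneg S])).trans (abs_nonneg _)
    · have hφ : 0 ≤ φ := by by_contra hc; nlinarith
      rw [abs_of_pos hd] at *
      refine le_trans ?_ (le_abs_self _)
      have : l * (D' * d - T) ≤ l * (φ * G.μ x + D * d - S) :=
        mul_le_mul_of_nonneg_left (by nlinarith) hl
      linarith
  refine key (u x - v x) (f (v x) - f (u x)) ?_ _ (W + G.κ x) _
    (Finset.sum_nonneg fun y _ => G.w_nonneg x y) (by linarith) _ hS
  rcases le_total (u x) (v x) with h | h
  · exact mul_nonneg_of_nonpos_of_nonpos (by linarith) (sub_nonpos.2 (hf h))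
  · exact mul_nonneg (by linarith) (sub_nonneg.2 (hf h))

/-- The graph in `ℓ^p` of the restriction of `𝒜` to `D`. -/
def graphOn (p : ℝ) (f : ℝ → ℝ) (D : Set (X → ℝ)) :
    Set (lp (fun _ : X => ℝ) (ENNReal.ofReal p) × lp (fun _ : X => ℝ) (ENNReal.ofReal p)) :=
  (fun u => (G.toLp p u, G.toLp p (G.opA f u))) '' D

/-- Both elements are approximated along the same exhaustion, so at level `n` one and the same
accretive operator compares the approximants; the inequality survives the limit. -/
theorem isAccretive_omega [Fact (1 ≤ ENNReal.ofReal p)] (hp : 1 ≤ p) {f : ℝ → ℝ}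
    (hf : Antitone f) (E : ℕ → Finset X) : IsAccretive (G.graphOn p f (G.Omega p f E)) := by
  have hp0 : 0 < p := by linarith
  rintro _ ⟨u, ⟨⟨hu1, hu2, hu3⟩, a, ha, hau, haA⟩, rfl⟩ _ ⟨v, ⟨⟨hv1, hv2, hv3⟩, b, hb, hbv, hbA⟩, rfl⟩
    l hl
  have ma : ∀ n, G.MemEllp p (a n) := fun n => memEllp_of_support_subset hp0 (ha n)
  have mb : ∀ n, G.MemEllp p (b n) := fun n => memEllp_of_support_subset hp0 (hb n)
  have mA : ∀ (c : ℕ → X → ℝ) n, G.MemEllp p (G.opADir f (E n : Set X) (c n)) := fun c n =>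
    memEllp_of_support_subset hp0 (G.support_opADir_subset f _ _)
  rw [← MemEllp.tendsto_toLp_iff hp0 ma hu1] at hau
  rw [← MemEllp.tendsto_toLp_iff hp0 mb hv1] at hbv
  rw [← MemEllp.tendsto_toLp_iff hp0 (mA a) hu3] at haA
  rw [← MemEllp.tendsto_toLp_iff hp0 (mA b) hv3] at hbA
  refine le_of_tendsto_of_tendsto (hau.sub hbv).norm
    ((hau.sub hbv).add ((haA.sub hbA).const_smul l)).norm (Eventually.of_forall fun n => ?_)
  have h := G.ellpNorm_sub_le_of_support hp hf (E n) (ha n) (hb n) hl.le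
  have m1 := (ma n).sub hp0 (mb n)
  have m2 := (mA a n).sub hp0 (mA b n)
  have m3 := m2.smul hp0 l
  rw [← m1.norm_toLp hp0, ← (m1.add hp0 m3).norm_toLp hp0, m1.toLp_add hp0 m3,
    m2.toLp_smul hp0, (ma n).toLp_sub hp0 (mb n), (mA a n).toLp_sub hp0 (mA b n)] at h
  exact h

end Accretive

end WeightedGraph

/-! ### The absorption term and the scalar resolvent equation. -/

theorem neg_absorption_of_nonneg {q : ℝ} (hq : 0 < q) {s : ℝ} (hs : 0 ≤ s) :
    -absorption q s = s ^ q := by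
  rw [absorption, neg_neg, abs_of_nonneg hs]
  rcases hs.eq_or_lt with h | h
  · rw [← h, mul_zero, Real.zero_rpow hq.ne']
  · nth_rewrite 2 [← Real.rpow_one s]
    rw [← Real.rpow_add h]; ring_nf

theorem absorption_neg (q s : ℝ) : absorption q (-s) = -absorption q s := by
  simp [absorption]

theorem absorption_zero (q : ℝ) : absorption q 0 = 0 := by simp [absorption]

theorem antitone_absorption {q : ℝ} (hq : 0 < q) : Antitone (absorption q) := by
  have hpos : ∀ s t : ℝ, 0 ≤ s → s ≤ t → absorption q t ≤ absorption q s := by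
    intro s t hs hst
    have h1 := neg_absorption_of_nonneg hq hs
    have h2 := neg_absorption_of_nonneg hq (hs.trans hst)
    have := Real.rpow_le_rpow hs hst hq.le
    linarith
  intro s t hst
  rcases le_total 0 s with hs | hs
  · exact hpos s t hs hst
  · rcases le_total 0 t with ht | ht
    · have h1 := hpos 0 t le_rfl ht
      have h2 := hpos 0 (-s) le_rfl (by linarith)
      rw [absorption_neg, absorption_zero] at h2
      rw [absorption_zero] at h1
      linarith
    · have := hpos (-t) (-s) (by linarith) (by linarith)
      rw [absorption_neg, absorption_neg] at this
      linarith

theorem exists_nonneg_add_rpow_eq {a l q s : ℝ} (ha : 1 ≤ a) (hl : 0 ≤ l) (hq : 0 < q)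
    (hs : 0 ≤ s) : ∃ r, 0 ≤ r ∧ a * r + l * r ^ q = s := by
  have hc : ContinuousOn (fun r : ℝ => a * r + l * r ^ q) (Set.Icc 0 s) := by
    refine Continuous.continuousOn ?_
    have := Real.continuous_rpow_const hq.le
    fun_prop
  have h := intermediate_value_Icc hs hc
  have h0 : a * 0 + l * (0 : ℝ) ^ q = 0 := by rw [Real.zero_rpow hq.ne']; ring
  have h1 : s ≤ a * s + l * s ^ q := by
    have := mul_nonneg hl (Real.rpow_nonneg hs q)
    nlinarith
  obtain ⟨r, hr, e⟩ := h (show s ∈ _ from ⟨by simp only [h0]; exact hs, h1⟩)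
  exact ⟨r, hr.1, e⟩

theorem le_of_add_rpow_le {a l q r r' : ℝ} (ha : 1 ≤ a) (hl : 0 ≤ l) (hq : 0 < q)
    (hr' : 0 ≤ r') (h : a * r + l * r ^ q ≤ a * r' + l * r' ^ q) : r ≤ r' := by
  by_contra hc
  push Not at hc
  have := mul_le_mul_of_nonneg_left (Real.rpow_le_rpow hr' hc.le hq.le) hl
  nlinarith

/-! ### Least solutions of the resolvent equation, and membership in `Ω_p`. -/

namespace WeightedGraph

variable {X : Type*} (G : WeightedGraph X)

/-- The diagonal coefficient of `id + l Δ`. -/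
noncomputable def diagCoeff (l : ℝ) (x : X) : ℝ := 1 + l * (∑' y, G.w x y + G.κ x) / G.μ x

theorem one_le_diagCoeff {l : ℝ} (hl : 0 ≤ l) (x : X) : 1 ≤ G.diagCoeff l x := by
  have h1 := G.μ_pos x
  have h2 := G.κ_nonneg x
  have h3 : 0 ≤ ∑' y, G.w x y := tsum_nonneg fun y => G.w_nonneg x y
  have : 0 ≤ l * (∑' y, G.w x y + G.κ x) / G.μ x := by positivity
  rw [diagCoeff]; linarith

/-- This separates a part increasing in `v x` from a coupling increasing in the neighbouring values
(for `l ≥ 0`), the structure behind every comparison below. -/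
theorem add_mul_opA_eq {q : ℝ} (hq : 0 < q) (l : ℝ) {v : X → ℝ} {x : X} (h0 : 0 ≤ v x)
    (hv : Summable fun y => G.w x y * v y) :
    v x + l * G.opA (absorption q) v x
      = G.diagCoeff l x * v x + l * v x ^ q - l / G.μ x * ∑' y, G.w x y * v y := by
  rw [opA, neg_absorption_of_nonneg hq h0, G.lap_eq hv, diagCoeff]
  have := (G.μ_pos x).ne'
  field_simp
  ring

/-- `v` is a supersolution on `Y` of the resolvent equation with right-hand side `g`. -/
def IsSupersolution (q l : ℝ) (g : X → ℝ) (Y : Set X) (v : X → ℝ) : Prop :=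
  (∀ x, 0 ≤ v x) ∧ (∀ x, Summable fun y => G.w x y * v y) ∧
  ∀ x ∈ Y, g x + l / G.μ x * ∑' y, G.w x y * v y ≤ G.diagCoeff l x * v x + l * v x ^ q

variable {G}

theorem summable_of_bounded {v : X → ℝ} {c : ℝ} (h0 : ∀ x, 0 ≤ v x) (hc : ∀ x, v x ≤ c) (x : X) :
    Summable fun y => G.w x y * v y :=
  Summable.of_nonneg_of_le (fun y => mul_nonneg (G.w_nonneg x y) (h0 y))
    (fun y => mul_le_mul_of_nonneg_left (hc y) (G.w_nonneg x y)) ((G.w_summable x).mul_right c)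

theorem coupling_mono {l : ℝ} (hl : 0 ≤ l) {x : X} {v v' : X → ℝ}
    (hv : Summable fun y => G.w x y * v y) (hv' : Summable fun y => G.w x y * v' y)
    (h : ∀ y, v y ≤ v' y) :
    l / G.μ x * ∑' y, G.w x y * v y ≤ l / G.μ x * ∑' y, G.w x y * v' y :=
  mul_le_mul_of_nonneg_left
    (hv.tsum_le_tsum (fun y => mul_le_mul_of_nonneg_left (h y) (G.w_nonneg x y)) hv')
    (div_nonneg hl (G.μ_pos x).le)

/-- On constants the Laplacian reduces to the killing term, which has the favourable sign. -/
theorem isSupersolution_const {q l z : ℝ} (hl : 0 ≤ l) {g : X → ℝ} (hz : 0 ≤ z)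
    (hg : ∀ x, g x ≤ z + l * z ^ q) (Y : Set X) : G.IsSupersolution q l g Y fun _ => z := by
  refine ⟨fun _ => hz, fun x => (G.w_summable x).mul_right z, fun x _ => ?_⟩
  have h1 := G.μ_pos x
  have h2 : 0 ≤ l * G.κ x * z / G.μ x := by have := G.κ_nonneg x; positivity
  rw [tsum_mul_right, diagCoeff]
  have e : (1 + l * (∑' y, G.w x y + G.κ x) / G.μ x) * z
      = z + l / G.μ x * ((∑' y, G.w x y) * z) + l * G.κ x * z / G.μ x := by
    field_simp; ring
  rw [e]
  linarith [hg x]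

theorem isSupersolution_const_self {q l c : ℝ} (hl : 0 ≤ l) {g : X → ℝ} (hc : 0 ≤ c)
    (hg : ∀ x, g x ≤ c) (Y : Set X) : G.IsSupersolution q l g Y fun _ => c :=
  isSupersolution_const hl hc (fun x => (hg x).trans (le_add_of_nonneg_right
    (mul_nonneg hl (Real.rpow_nonneg hc q)))) Y

theorem IsSupersolution.inf {q l : ℝ} (hl : 0 ≤ l) {g : X → ℝ} {Y : Set X} {v v' : X → ℝ}
    (hv : G.IsSupersolution q l g Y v) (hv' : G.IsSupersolution q l g Y v') :
    G.IsSupersolution q l g Y fun x => min (v x) (v' x) := by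
  have hs : ∀ x, Summable fun y => G.w x y * min (v y) (v' y) := fun x =>
    Summable.of_nonneg_of_le (fun y => mul_nonneg (G.w_nonneg x y) (le_min (hv.1 y) (hv'.1 y)))
      (fun y => mul_le_mul_of_nonneg_left (min_le_left _ _) (G.w_nonneg x y)) (hv.2.1 x)
  refine ⟨fun x => le_min (hv.1 x) (hv'.1 x), hs, fun x hx => ?_⟩
  have h1 := coupling_mono hl (hs x) (hv.2.1 x) fun y => min_le_left _ _
  have h2 := coupling_mono hl (hs x) (hv'.2.1 x) fun y => min_le_right _ _
  have h3 := hv.2.2 x hx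
  have h4 := hv'.2.2 x hx
  beta_reduce
  rcases le_total (v x) (v' x) with h | h
  · rw [min_eq_left h]; linarith
  · rw [min_eq_right h]; linarith

/-- The Dirichlet problem on `Y` for the resolvent equation has a least nonnegative
supersolution, which is a solution. -/
theorem exists_least_solution {q l c : ℝ} (hq : 0 < q) (hl : 0 ≤ l) {g : X → ℝ}
    (hg0 : ∀ x, 0 ≤ g x) (hgc : ∀ x, g x ≤ c) (hc : 0 ≤ c) (Y : Set X) :
    ∃ u : X → ℝ, (∀ x, 0 ≤ u x) ∧ (∀ x, u x ≤ c) ∧ (∀ x ∉ Y, u x = 0) ∧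
      (∀ x ∈ Y, G.diagCoeff l x * u x + l * u x ^ q
        = g x + l / G.μ x * ∑' y, G.w x y * u y) ∧
      ∀ v, G.IsSupersolution q l g Y v → ∀ x, u x ≤ v x := by
  classical
  let P : Set (X → ℝ) := {v | G.IsSupersolution q l g Y v ∧ ∀ x, v x ≤ c}
  have hcP : (fun _ => c) ∈ P := ⟨isSupersolution_const_self hl hc hgc Y, fun _ => le_rfl⟩
  have : Nonempty P := ⟨⟨_, hcP⟩⟩
  -- Perron's method: the pointwise infimum of all supersolutions bounded by `c`.
  let u : X → ℝ := fun x => ⨅ v : P, v.1 x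
  have hbdd : ∀ x, BddBelow (Set.range fun v : P => v.1 x) := fun x =>
    ⟨0, by rintro _ ⟨v, rfl⟩; exact v.2.1.1 x⟩
  have hule : ∀ v ∈ P, ∀ x, u x ≤ v x := fun v hv x => ciInf_le (hbdd x) (⟨v, hv⟩ : P)
  have hu0 : ∀ x, 0 ≤ u x := fun x => le_ciInf fun v => v.2.1.1 x
  have huc : ∀ x, u x ≤ c := hule _ hcP
  have hus := summable_of_bounded (G := G) hu0 huc
  have hs0 : ∀ x, 0 ≤ g x + l / G.μ x * ∑' y, G.w x y * u y := fun x => by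
    have h1 := G.μ_pos x
    have h2 : 0 ≤ ∑' y, G.w x y * u y := tsum_nonneg fun y => mul_nonneg (G.w_nonneg x y) (hu0 y)
    have := hg0 x
    positivity
  choose σ hσ0 hσ using fun x =>
    exists_nonneg_add_rpow_eq (G.one_le_diagCoeff hl x) hl hq (hs0 x)
  -- `T` solves the scalar equation at each node with the coupling frozen at `u`. It lies below
  -- every member of `P`, hence below `u`; its own coupling is then smaller, so `T` belongs to `P`
  -- and equals `u`.
  let T : X → ℝ := fun x => if x ∈ Y then σ x else 0
  have hT0 : ∀ x, 0 ≤ T x := fun x => by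
    by_cases h : x ∈ Y <;> simp [T, h, hσ0]
  have hTv : ∀ v ∈ P, ∀ x, T x ≤ v x := by
    intro v hv x
    by_cases h : x ∈ Y
    · simp only [T, h, if_true]
      refine le_of_add_rpow_le (G.one_le_diagCoeff hl x) hl hq (hv.1.1 x) ?_
      rw [hσ]
      have := coupling_mono hl (hus x) (hv.1.2.1 x) (hule v hv)
      linarith [hv.1.2.2 x h]
    · simp only [T, h, if_false]; exact hv.1.1 x
  have hTu : ∀ x, T x ≤ u x := fun x => le_ciInf fun v => hTv v.1 v.2 x
  have hTc : ∀ x, T x ≤ c := fun x => (hTu x).trans (huc x)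
  have hTs := summable_of_bounded (G := G) hT0 hTc
  have hTP : T ∈ P := by
    refine ⟨⟨hT0, hTs, fun x hx => ?_⟩, hTc⟩
    have e : T x = σ x := by simp [T, hx]
    rw [e, hσ]
    have := coupling_mono hl (hTs x) (hus x) hTu
    linarith
  have hTeq : u = T := funext fun x => le_antisymm (hule T hTP x) (hTu x)
  refine ⟨u, hu0, huc, fun x hx => ?_, fun x hx => ?_, fun v hv x => ?_⟩
  · rw [hTeq]; simp [T, hx]
  · have e : u x = σ x := by rw [hTeq]; simp [T, hx]
    rw [e]; exact hσ x
  · have := hule _ (show (fun x => min (v x) c) ∈ P from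
      ⟨hv.inf hl (isSupersolution_const_self hl hc hgc Y), fun x => min_le_right _ _⟩) x
    exact this.trans (min_le_left _ _)

theorem IsExhaustion.eventually_mem {E : ℕ → Finset X} (hE : IsExhaustion E) (x : X) :
    ∀ᶠ n in atTop, x ∈ E n := by
  obtain ⟨n, hn⟩ := hE.cover x
  filter_upwards [eventually_ge_atTop n] with m hm
  exact hE.mono hm hn

theorem exists_isExhaustion [Countable X] : ∃ E : ℕ → Finset X, IsExhaustion E := by
  classical
  obtain ⟨f, hf⟩ := Countable.exists_injective_nat X
  have hfin : ∀ n : ℕ, {x | f x ≤ n}.Finite := fun n =>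
    (Set.finite_Iic n).preimage hf.injOn
  refine ⟨fun n => (hfin n).toFinset, ⟨fun m n hmn x hx => ?_, fun x => ⟨f x, by simp⟩⟩⟩
  simp only [Set.Finite.mem_toFinset, Set.mem_ofPred_eq] at hx ⊢
  omega

/-- The least nonnegative solution of the resolvent equation lies in `Ω_p` of any exhaustion. -/
theorem mem_omega_of_least {p q l c : ℝ} (hp : 1 ≤ p) (hq : 0 < q) (hl : 0 < l) {g : X → ℝ}
    (hg0 : ∀ x, 0 ≤ g x) (hgc : ∀ x, g x ≤ c) (hc : 0 ≤ c) (hgp : G.MemEllp p g) {u : X → ℝ}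
    (hu0 : ∀ x, 0 ≤ u x) (huc : ∀ x, u x ≤ c)
    (hue : ∀ x, G.diagCoeff l x * u x + l * u x ^ q = g x + l / G.μ x * ∑' y, G.w x y * u y)
    (hul : ∀ v, G.IsSupersolution q l g Set.univ v → ∀ x, u x ≤ v x)
    {E : ℕ → Finset X} (hE : IsExhaustion E) : u ∈ G.Omega p (absorption q) E := by
  have hp0 : 0 < p := by linarith
  choose v hv0 hvc hvz hve hvl using fun n =>
    exists_least_solution (G := G) hq hl.le hg0 hgc hc (E n : Set X)
  have hvs := fun n => summable_of_bounded (G := G) (hv0 n) (hvc n)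
  have hus := summable_of_bounded (G := G) hu0 huc
  have hvu : ∀ n x, v n x ≤ u x := fun n =>
    hvl n u ⟨hu0, hus, fun x _ => (hue x).ge⟩
  have hmono : ∀ x, Monotone fun n => v n x := fun x m n hmn =>
    hvl m (v n) ⟨hv0 n, hvs n, fun y hy => (hve n y (hE.mono hmn hy)).ge⟩ x
  -- The increasing limit of the Dirichlet solutions is a supersolution on all of `X`, so minimality
  -- of `u` forces equality.
  have hlim : ∀ x, Tendsto (fun n => v n x) atTop (𝓝 (u x)) := by
    let s : X → ℝ := fun x => ⨆ n, v n x
    have hs : ∀ x, Tendsto (fun n => v n x) atTop (𝓝 (s x)) := fun x =>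
      tendsto_atTop_ciSup (hmono x) ⟨c, by rintro _ ⟨n, rfl⟩; exact hvc n x⟩
    have hs0 : ∀ x, 0 ≤ s x := fun x => ge_of_tendsto' (hs x) fun n => hv0 n x
    have hsc : ∀ x, s x ≤ c := fun x => le_of_tendsto' (hs x) fun n => hvc n x
    have hsu : ∀ x, s x ≤ u x := fun x => le_of_tendsto' (hs x) fun n => hvu n x
    have hus' := hul s ⟨hs0, summable_of_bounded hs0 hsc, fun x _ => ?_⟩
    · intro x
      rw [le_antisymm (hus' x) (hsu x)]; exact hs x
    · have h1 : Tendsto (fun n => g x + l / G.μ x * ∑' y, G.w x y * v n y) atTop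
          (𝓝 (g x + l / G.μ x * ∑' y, G.w x y * s y)) := by
        refine Tendsto.const_add _ (Tendsto.const_mul _ ?_)
        refine tendsto_tsum_of_dominated_convergence ((G.w_summable x).mul_right c)
          (fun y => (hs y).const_mul _) (Eventually.of_forall fun n y => ?_)
        rw [Real.norm_of_nonneg (mul_nonneg (G.w_nonneg x y) (hv0 n y))]
        exact mul_le_mul_of_nonneg_left (hvc n y) (G.w_nonneg x y)
      have h2 : Tendsto (fun n => G.diagCoeff l x * v n x + l * v n x ^ q) atTop
          (𝓝 (G.diagCoeff l x * s x + l * s x ^ q)) :=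
        ((hs x).const_mul _).add (((hs x).rpow_const (Or.inr hq.le)).const_mul _)
      refine le_of_tendsto_of_tendsto h1 h2 ?_
      filter_upwards [hE.eventually_mem x] with n hn
      exact (hve n x hn).ge
  have hsupp : ∀ n, Function.support (v n) ⊆ (E n : Set X) := fun n x hx => by
    by_contra h; exact hx (hvz n x h)
  -- The Dirichlet solutions have `ℓ^p` norm at most that of `g`; pointwise limits on finite sets
  -- transfer the bound.
  have hup : G.MemEllp p u := by
    refine summable_of_sum_le (c := ∑' x, |g x| ^ p * G.μ x)
      (fun x => by have := G.μ_pos x; positivity) fun F => ?_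
    have h1 : Tendsto (fun n => ∑ x ∈ F, |v n x| ^ p * G.μ x) atTop
        (𝓝 (∑ x ∈ F, |u x| ^ p * G.μ x)) :=
      tendsto_finsetSum _ fun x _ =>
        ((hlim x).abs.rpow_const (Or.inr hp0.le)).mul_const _
    refine le_of_tendsto' h1 fun n => ?_
    have h2 : ∑ x ∈ E n, v n x ^ p * G.μ x ≤ ∑ x ∈ E n, g x ^ p * G.μ x := by
      refine G.sum_rpow_le_of_subsolution hp (E n) hl.le (hv0 n) hg0 fun x hx => ?_
      have e1 := hve n x hx
      have hμ := G.μ_pos x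
      rw [G.tsum_indicator_weight (E n) (v n) (hsupp n) x, diagCoeff] at e1
      have e2 : ∑ y ∈ E n, G.w x y * (v n x - v n y)
          = (∑ y ∈ E n, G.w x y) * v n x - ∑ y ∈ E n, G.w x y * v n y := by
        rw [Finset.sum_mul, ← Finset.sum_sub_distrib]
        exact Finset.sum_congr rfl fun y _ => by ring
      have e3 := mul_le_mul_of_nonneg_right (G.sum_weight_le (E n) x) (hv0 n x)
      have e4 := mul_nonneg (G.κ_nonneg x) (hv0 n x)
      have e5 := mul_nonneg hl.le (mul_nonneg hμ.le (Real.rpow_nonneg (hv0 n x) q))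
      have e6 : g x * G.μ x = v n x * G.μ x + l * (((∑' y, G.w x y) + G.κ x) * v n x
          - ∑ y ∈ E n, G.w x y * v n y) + l * (G.μ x * v n x ^ q) := by
        have : g x = (1 + l * (∑' y, G.w x y + G.κ x) / G.μ x) * v n x + l * v n x ^ q
          - l / G.μ x * ∑ y ∈ E n, G.w x y * v n y := by linarith
        rw [this]; field_simp; ring
      rw [e2, e6]
      have := mul_le_mul_of_nonneg_left (show (∑ y ∈ E n, G.w x y) * v n x
        - ∑ y ∈ E n, G.w x y * v n y ≤ ((∑' y, G.w x y) + G.κ x) * v n x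
          - ∑ y ∈ E n, G.w x y * v n y by linarith) hl.le
      linarith
    calc ∑ x ∈ F, |v n x| ^ p * G.μ x ≤ ∑' x, |v n x| ^ p * G.μ x :=
          (memEllp_of_support_subset hp0 (hsupp n)).sum_le_tsum F
            fun x _ => by have := G.μ_pos x; positivity
      _ = ∑ x ∈ E n, v n x ^ p * G.μ x := by
          rw [tsum_eq_sum (s := E n) fun x hx => by
            rw [hvz n x hx, abs_zero, Real.zero_rpow hp0.ne', zero_mul]]
          exact Finset.sum_congr rfl fun x _ => by rw [abs_of_nonneg (hv0 n x)]
      _ ≤ ∑ x ∈ E n, |g x| ^ p * G.μ x := by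
          refine h2.trans_eq (Finset.sum_congr rfl fun x _ => by rw [abs_of_nonneg (hg0 x)])
      _ ≤ _ := hgp.sum_le_tsum _ fun x _ => by have := G.μ_pos x; positivity
  have hopA : G.opA (absorption q) u = l⁻¹ • (g - u) := by
    ext x
    have h1 := G.add_mul_opA_eq hq l (hu0 x) (hus x)
    rw [hue x, add_sub_cancel_right] at h1
    rw [Pi.smul_apply, Pi.sub_apply, smul_eq_mul, ← h1]
    field_simp; ring
  have hgu := hgp.sub hp0 hup
  refine ⟨⟨hup, fun x => ?_, ?_⟩, v, hsupp, ?_, ?_⟩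
  · simpa only [abs_of_nonneg (hu0 _)] using hus x
  · rw [hopA]; exact hgu.smul hp0 _
  · refine tendsto_ellpNorm_zero_of_dominated hp0 hup (fun n x => ?_) fun x => ?_
    · rw [Pi.sub_apply, abs_le, abs_of_nonneg (hu0 x)]
      constructor <;> linarith [hv0 n x, hvu n x, hu0 x]
    · have := (hlim x).sub_const (u x)
      rwa [sub_self] at this
  · have hin : ∀ n, ∀ x ∈ E n, (G.opADir (absorption q) (E n : Set X) (v n)
        - G.opA (absorption q) u) x = l⁻¹ * (u x - v n x) := by
      intro n x hx
      have h1 := G.add_mul_opA_eq hq l (hv0 n x) (hvs n x)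
      rw [hve n x hx, add_sub_cancel_right] at h1
      rw [Pi.sub_apply, hopA, G.opADir_of_mem _ _ _ hx, Set.indicator_eq_self.2 (hsupp n),
        Pi.smul_apply, Pi.sub_apply, smul_eq_mul, ← h1]
      field_simp; ring
    -- One majorant for both regions: the difference is `(u - v n) / l` on `E n` and `-(g - u) / l`
    -- off it.
    refine tendsto_ellpNorm_zero_of_dominated hp0 (b := l⁻¹ • (g + u))
      ((hgp.add hp0 hup).smul hp0 _) (fun n x => ?_) fun x => ?_
    · have hl' : 0 < l⁻¹ := inv_pos.2 hl
      rw [Pi.smul_apply, Pi.add_apply, smul_eq_mul, abs_mul, abs_of_pos hl',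
        abs_of_nonneg (add_nonneg (hg0 x) (hu0 x))]
      by_cases hx : x ∈ E n
      · rw [hin n x hx, abs_mul, abs_of_pos hl']
        refine mul_le_mul_of_nonneg_left ?_ hl'.le
        rw [abs_le]; constructor <;> linarith [hv0 n x, hvu n x, hg0 x, hu0 x]
      · rw [Pi.sub_apply, G.opADir_of_notMem _ _ _ (by simpa using hx), hopA, zero_sub, abs_neg,
          Pi.smul_apply, Pi.sub_apply, smul_eq_mul, abs_mul, abs_of_pos hl']
        refine mul_le_mul_of_nonneg_left ?_ hl'.le
        rw [abs_le]; constructor <;> linarith [hg0 x, hu0 x]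
    · have h1 : Tendsto (fun n => l⁻¹ * (u x - v n x)) atTop (𝓝 0) := by
        have := ((hlim x).const_sub (u x)).const_mul l⁻¹
        rwa [sub_self, mul_zero] at this
      refine h1.congr' ?_
      filter_upwards [hE.eventually_mem x] with n hn
      exact (hin n x hn).symm

/-- By symmetry of `w` this column condition is `CondC` at `y`, or plain summability of the weights
if `p = 1`. It controls `𝒜` applied to a point mass. -/
theorem memEllp_weight {p : ℝ} (hp : 1 ≤ p) (hC : 1 < p → G.CondC p) (y : X) :
    G.MemEllp p fun x => G.w x y / G.μ x := by
  have e : ∀ x, |G.w x y / G.μ x| ^ p * G.μ x = G.w y x ^ p / G.μ x ^ (p - 1) := by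
    intro x
    have h1 := G.μ_pos x
    rw [abs_of_nonneg (div_nonneg (G.w_nonneg x y) h1.le), Real.div_rpow (G.w_nonneg x y) h1.le,
      Real.rpow_sub_one h1.ne', G.w_symm]
    have : G.μ x ^ p ≠ 0 := (Real.rpow_pos_of_pos h1 p).ne'
    field_simp
  rw [MemEllp]
  simp only [e]
  rcases hp.eq_or_lt with h | h
  · subst h; simpa using G.w_summable y
  · exact hC h y

theorem memEllp_opA_of_support {p : ℝ} (hp : 1 ≤ p) (hC : 1 < p → G.CondC p) {f : ℝ → ℝ}
    (hf : f 0 = 0) {F : Finset X} {u : X → ℝ} (hu : Function.support u ⊆ F) :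
    G.MemEllp p (G.opA f u) := by
  have hp0 : 0 < p := by linarith
  have hz : ∀ x ∉ F, u x = 0 := fun x hx => by by_contra h0; exact hx (hu h0)
  have hs : ∀ x, Summable fun y => G.w x y * u y := fun x =>
    summable_of_ne_finset_zero (s := F) fun y hy => by rw [hz y hy, mul_zero]
  have e : G.opA f u = (fun x => -f (u x) + (∑' y, G.w x y + G.κ x) * u x / G.μ x)
      + ∑ y ∈ F, (-u y) • fun x => G.w x y / G.μ x := by
    ext x
    rw [opA, G.lap_eq (hs x), G.tsum_indicator_weight F u hu]
    simp only [Pi.add_apply, Finset.sum_apply, Pi.smul_apply, smul_eq_mul]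
    rw [sub_div, Finset.sum_div, sub_eq_add_neg, ← Finset.sum_neg_distrib, ← add_assoc]
    congr 1
    exact Finset.sum_congr rfl fun y _ => by ring
  have hsum : ∀ S : Finset X, G.MemEllp p (∑ y ∈ S, (-u y) • fun x => G.w x y / G.μ x) := by
    classical
    intro S
    induction S using Finset.induction_on with
    | empty =>
      exact memEllp_of_support_subset hp0 (E := ∅) (by simp)
    | insert a S ha ih =>
      rw [Finset.sum_insert ha]
      exact ((memEllp_weight hp hC a).smul hp0 _).add hp0 ih
  rw [e]
  refine MemEllp.add hp0 (memEllp_of_support_subset hp0 (E := F) fun x hx => ?_) (hsum F)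
  by_contra h
  exact hx (by simp [hz x h, hf])

/-- Finitely supported functions belong to `Ω_p` of any exhaustion. -/
theorem mem_omega_of_support {p : ℝ} (hp : 1 ≤ p) (hC : 1 < p → G.CondC p) {f : ℝ → ℝ}
    (hf : f 0 = 0) {F : Finset X} {u : X → ℝ} (hu : Function.support u ⊆ F)
    {E : ℕ → Finset X} (hE : IsExhaustion E) : u ∈ G.Omega p f E := by
  classical
  have hp0 : 0 < p := by linarith
  have hz : ∀ x ∉ F, u x = 0 := fun x hx => by by_contra h0; exact hx (hu h0)
  have hA := memEllp_opA_of_support hp hC hf hu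
  have hev : ∀ᶠ n in atTop, F ⊆ E n :=
    (Filter.eventually_all_finset F).2 fun x _ => hE.eventually_mem x
  refine ⟨⟨memEllp_of_support_subset hp0 hu, fun x => ?_, hA⟩,
    -- The function itself is its approximant once `E n` contains its support; the error is then
    -- `-𝒜u` off `E n` and zero on it.
    fun n => if F ⊆ E n then u else 0, fun n => ?_, ?_, ?_⟩
  · exact summable_of_ne_finset_zero (s := F) fun y hy => by rw [hz y hy, abs_zero, mul_zero]
  · by_cases h : F ⊆ E n
    · simp only [h, if_true]; exact hu.trans (by exact_mod_cast h)
    · simp [h]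
  · refine tendsto_const_nhds.congr' ?_
    filter_upwards [hev] with n hn
    simp [hn, ellpNorm, Real.zero_rpow hp0.ne', Real.zero_rpow (inv_pos.2 hp0).ne']
  · have hin : ∀ n, F ⊆ E n → ∀ x ∈ E n, G.opADir f (E n : Set X) u x = G.opA f u x := by
      intro n hn x hx
      rw [G.opADir_of_mem f _ _ hx, Set.indicator_eq_self.2 (hu.trans (by exact_mod_cast hn))]
    have h0 : ∀ n x, G.opADir f (E n : Set X) 0 x = 0 := by
      intro n x
      by_cases hx : x ∈ E n
      · rw [G.opADir_of_mem f _ _ hx]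
        simp [opA, lap, hf]
      · exact G.opADir_of_notMem f _ _ (by simpa using hx)
    refine tendsto_ellpNorm_zero_of_dominated hp0 hA (fun n x => ?_) fun x => ?_
    · by_cases h : F ⊆ E n
      · simp only [h, if_true, Pi.sub_apply]
        by_cases hx : x ∈ E n
        · rw [hin n h x hx, sub_self, abs_zero]; exact abs_nonneg _
        · rw [G.opADir_of_notMem f _ _ (by simpa using hx), zero_sub, abs_neg]
      · simp only [h, if_false, Pi.sub_apply, h0, zero_sub, abs_neg, le_refl]
    · refine tendsto_const_nhds.congr' ?_
      filter_upwards [hev, hE.eventually_mem x] with n hn hx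
      simp only [hn, if_true, Pi.sub_apply, hin n hn x hx, sub_self]

end WeightedGraph

/-! ### Mild solutions: uniqueness in `Ω_p` and existence. -/

namespace WeightedGraph

variable {X : Type*} {G : WeightedGraph X} {p q : ℝ}

theorem stepFun_zero (N : ℕ) (t : ℕ → ℝ) (v : ℕ → X → ℝ) : stepFun N t v 0 = v 0 := by
  ext x; simp [stepFun]

theorem stepFun_of_mem_Ioc {N : ℕ} {t : ℕ → ℝ} (h0 : t 0 = 0) (ht : ∀ k < N, t k < t (k + 1))
    (v : ℕ → X → ℝ) {k : ℕ} (hk : k < N) {s : ℝ} (hs : s ∈ Set.Ioc (t k) (t (k + 1))) :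
    stepFun N t v s = v (k + 1) := by
  ext x
  have hs0 : s ≠ 0 := by
    have := partition_le ht (Nat.zero_le k) hk.le
    have := hs.1
    intro h; linarith
  rw [stepFun, if_neg hs0, Finset.sum_eq_single k]
  · rw [Set.indicator_of_mem hs]
  · intro j hj hjk
    have hj := Finset.mem_range.1 hj
    refine Set.indicator_of_notMem (fun hsj => ?_) _
    rcases lt_or_gt_of_ne hjk with h | h
    · have := partition_le ht (show j + 1 ≤ k from h) hk.le
      linarith [hs.1, hsj.2]
    · have := partition_le ht (show k + 1 ≤ j from h) hj.le
      linarith [hs.2, hsj.1]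
  · intro h; exact absurd (Finset.mem_range.2 hk) h

theorem ellpNorm_zero_sub (u : X → ℝ) : G.ellpNorm p (0 - u) = G.ellpNorm p u := by
  simp [ellpNorm]

/-- A mild solution with values in `D` is a limit of Euler schemes in `ℓ^p`. -/
theorem IsMildSolution.isEulerLimit [Fact (1 ≤ ENNReal.ofReal p)] (hp : 0 < p) {f : ℝ → ℝ}
    {D : Set (X → ℝ)} (hD : D ⊆ G.domA p f) {u₀ : X → ℝ} (hu₀ : G.MemEllp p u₀)
    {u : ℝ → X → ℝ} (hu : G.IsMildSolution p f D 0 u₀ u) {s : ℝ} (hs : 0 < s) :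
    IsEulerLimit (G.graphOn p f D) (G.toLp p u₀) (s + 1) s (G.toLp p (u s)) := by
  intro e he
  obtain ⟨hm, -, happ⟩ := hu (s + 1) (by linarith)
  -- With horizon `s + 1` and mesh at most `1 / 2`, the last grid point lies beyond `s`.
  obtain ⟨N, t, hd, v, H, ⟨hv0, hv⟩, hclose⟩ := happ (min e (1 / 2)) (by positivity)
  have hle : min e (1 / 2) ≤ e := min_le_left _ _
  have hle' : min e (1 / 2 : ℝ) ≤ 1 / 2 := min_le_right _ _
  have hvm : ∀ k ≤ N, G.MemEllp p (v k) := by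
    rintro (_ | k) hk
    · rw [hv0]; exact hu₀
    · exact (hD (hv k hk).1).1
  have hsN : s ≤ t N := by linarith [H.last_le]
  refine ⟨N, t, fun k => G.toLp p (hd k), fun k => G.toLp p (v k),
    ⟨H.t_zero, H.t_lt, fun k hk => ?_⟩, by simp only [hv0], H.t_le,
    fun k hk => (H.step_le k hk).trans hle, ?_, ?_⟩
  · obtain ⟨hvD, heq⟩ := hv k hk
    obtain ⟨m1, -, m2⟩ := hD hvD
    refine ⟨G.toLp p (G.opA f (v (k + 1))), ⟨_, hvD, rfl⟩, ?_⟩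
    rw [← m2.toLp_smul hp, ← m1.toLp_add hp (m2.smul hp _), ← (H.mem k hk).toLp_smul hp,
      ← (hvm k hk.le).toLp_add hp ((H.mem k hk).smul hp _)]
    congr 1
    ext x
    exact heq x
  · refine le_trans (le_of_eq ?_) (H.error_le.trans hle)
    refine Finset.sum_congr rfl fun k hk => ?_
    simp only [Pi.zero_apply, ellpNorm_zero_sub]
    rw [intervalIntegral.integral_const, smul_eq_mul,
      (H.mem k (Finset.mem_range.1 hk)).norm_toLp hp]
  · obtain ⟨k, hk, hks⟩ := exists_mem_Ioc_of_partition H.t_zero hs hsN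
    refine ⟨k, hk, hks, ?_⟩
    simp only
    rw [(hm s ⟨hs.le, by linarith⟩).norm_toLp_sub hp (hvm (k + 1) hk),
      ← stepFun_of_mem_Ioc H.t_zero H.t_lt v hk hks]
    exact (hclose s ⟨hs.le, hsN⟩).trans_le hle

theorem IsMildSolution.memEllp {f : ℝ → ℝ} {D : Set (X → ℝ)} {u₀ : X → ℝ} {u : ℝ → X → ℝ}
    (hu : G.IsMildSolution p f D 0 u₀ u) {s : ℝ} (hs : 0 ≤ s) : G.MemEllp p (u s) :=
  (hu (s + 1) (by linarith)).1 s ⟨hs, by linarith⟩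

/-- Time zero lies in no interval `(t k, t (k+1)]`, so Euler limits do not cover it and the value
comes from `stepFun` directly. -/
theorem IsMildSolution.apply_zero [Fact (1 ≤ ENNReal.ofReal p)] (hp : 0 < p) {f : ℝ → ℝ}
    {D : Set (X → ℝ)} {u₀ : X → ℝ} (hu₀ : G.MemEllp p u₀) {u : ℝ → X → ℝ}
    (hu : G.IsMildSolution p f D 0 u₀ u) : u 0 = u₀ := by
  have hm := hu.memEllp le_rfl
  refine hm.toLp_inj hp hu₀ ?_
  rw [← sub_eq_zero, ← norm_le_zero_iff, hm.norm_toLp_sub hp hu₀]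
  refine le_of_forall_pos_le_add fun e he => ?_
  obtain ⟨N, t, hd, v, H, ⟨hv0, -⟩, hclose⟩ := (hu 1 one_pos).2.2 e he
  have := hclose 0 ⟨le_rfl, by
    rw [← H.t_zero]; exact partition_le H.t_lt (Nat.zero_le N) le_rfl⟩
  rw [stepFun_zero, hv0] at this
  linarith

/-- Mild solutions with values in `Ω_p` are unique. -/
theorem IsMildSolution.unique (hp : 1 ≤ p) {f : ℝ → ℝ} (hf : Antitone f) {E : ℕ → Finset X}
    {u₀ : X → ℝ} (hu₀ : G.MemEllp p u₀)
    (hdense : ∀ e > 0, ∃ z ∈ G.Omega p f E, G.ellpNorm p (u₀ - z) < e) {u v : ℝ → X → ℝ}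
    (hu : G.IsMildSolution p f (G.Omega p f E) 0 u₀ u)
    (hv : G.IsMildSolution p f (G.Omega p f E) 0 u₀ v) {t : ℝ} (ht : 0 ≤ t) : u t = v t := by
  have hp0 : 0 < p := by linarith
  have : Fact (1 ≤ ENNReal.ofReal p) := ⟨by simpa using ENNReal.ofReal_le_ofReal hp⟩
  rcases ht.eq_or_lt with h | h
  · rw [← h, hu.apply_zero hp0 hu₀, hv.apply_zero hp0 hu₀]
  · have hD : G.Omega p f E ⊆ G.domA p f := fun z hz => hz.1
    refine (hu.memEllp ht).toLp_inj hp0 (hv.memEllp ht) ?_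
    refine IsEulerLimit.unique (G.isAccretive_omega hp hf E) ?_ (hu.isEulerLimit hp0 hD hu₀ h)
      (hv.isEulerLimit hp0 hD hu₀ h)
    rw [Metric.mem_closure_iff]
    intro e he
    obtain ⟨z, hz, hze⟩ := hdense e he
    refine ⟨_, ⟨_, ⟨z, hz, rfl⟩, rfl⟩, ?_⟩
    rwa [dist_eq_norm, hu₀.norm_toLp_sub hp0 hz.1.1]

/-- Functions in `ℓ^p` are approximated by finitely supported ones, which lie in every `Ω_p`. -/
theorem exists_omega_ellpNorm_lt [Countable X] (hp : 1 ≤ p) (hC : 1 < p → G.CondC p) {f : ℝ → ℝ}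
    (hf : f 0 = 0) {u₀ : X → ℝ} (hu₀ : G.MemEllp p u₀) {e : ℝ} (he : 0 < e) :
    ∃ z, (∀ E, IsExhaustion E → z ∈ G.Omega p f E) ∧ G.ellpNorm p (u₀ - z) < e := by
  have hp0 : 0 < p := by linarith
  obtain ⟨E, hE⟩ := exists_isExhaustion (X := X)
  have hlim : Tendsto (fun n => G.ellpNorm p (u₀ - (E n : Set X).indicator u₀)) atTop (𝓝 0) := by
    refine tendsto_ellpNorm_zero_of_dominated hp0 hu₀ (fun n x => ?_) fun x => ?_
    · by_cases hx : x ∈ (E n : Set X)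
      · rw [Pi.sub_apply, Set.indicator_of_mem hx, sub_self, abs_zero]; exact abs_nonneg _
      · rw [Pi.sub_apply, Set.indicator_of_notMem hx, sub_zero]
    · refine tendsto_const_nhds.congr' ?_
      filter_upwards [hE.eventually_mem x] with n hn
      rw [Pi.sub_apply, Set.indicator_of_mem (by exact_mod_cast hn), sub_self]
  obtain ⟨n, hn⟩ := (hlim.eventually (gt_mem_nhds he)).exists
  exact ⟨_, fun E' hE' => mem_omega_of_support hp hC hf
    (F := E n) Set.support_indicator_subset hE', hn⟩

/-- Nonnegative bounded functions in `ℓ^p(X, μ)`. -/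
def admissible (G : WeightedGraph X) (p : ℝ) : Set (X → ℝ) :=
  {g | (∀ x, 0 ≤ g x) ∧ (∃ c, 0 ≤ c ∧ ∀ x, g x ≤ c) ∧ G.MemEllp p g}

/-- `u` is the least nonnegative solution of `u + l 𝒜 u = g`. -/
structure IsMinimalResolvent (G : WeightedGraph X) (q l : ℝ) (g u : X → ℝ) : Prop where
  nonneg : ∀ x, 0 ≤ u x
  eq : ∀ x, G.diagCoeff l x * u x + l * u x ^ q = g x + l / G.μ x * ∑' y, G.w x y * u y
  le : ∀ v, G.IsSupersolution q l g Set.univ v → ∀ x, u x ≤ v x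

theorem exists_isMinimalResolvent [Countable X] (hp : 1 ≤ p) (hq : 0 < q) {l : ℝ} (hl : 0 < l)
    {g : X → ℝ} (hg : g ∈ G.admissible p) : ∃ u ∈ G.admissible p,
      G.IsMinimalResolvent q l g u ∧ (∀ E, IsExhaustion E → u ∈ G.Omega p (absorption q) E) ∧
      u + l • G.opA (absorption q) u = g := by
  obtain ⟨hg0, ⟨c, hc, hgc⟩, hgp⟩ := hg
  obtain ⟨u, hu0, huc, -, hue, hul⟩ :=
    exists_least_solution (G := G) hq hl.le hg0 hgc hc Set.univ
  have hO : ∀ E, IsExhaustion E → u ∈ G.Omega p (absorption q) E := fun E hE =>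
    mem_omega_of_least hp hq hl hg0 hgc hc hgp hu0 huc (fun x => hue x trivial) hul hE
  obtain ⟨E, hE⟩ := exists_isExhaustion (X := X)
  refine ⟨u, ⟨hu0, ⟨c, hc, huc⟩, (hO E hE).1.1⟩, ⟨hu0, fun x => hue x trivial, hul⟩, hO, ?_⟩
  ext x
  rw [Pi.add_apply, Pi.smul_apply, smul_eq_mul,
    G.add_mul_opA_eq hq l (hu0 x) (summable_of_bounded hu0 huc x), hue x trivial,
    add_sub_cancel_right]

/-- Existence of the mild solution as the limit of the Euler approximations `w n` of step size
`1 / (n + 1)` that consist of minimal resolvents. -/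
theorem exists_isMildSolution [Countable X] (hp : 1 ≤ p) (hC : 1 < p → G.CondC p) (hq : 0 < q)
    {u₀ : X → ℝ} (hu₀ : u₀ ∈ G.admissible p) :
    ∃ (u : ℝ → X → ℝ) (w : ℕ → ℕ → X → ℝ),
      (∀ n, w n 0 = u₀) ∧
      (∀ (n : ℕ) k, G.IsMinimalResolvent q (1 / ((n : ℝ) + 1)) (w n k) (w n (k + 1))) ∧
      (∀ s : ℝ, 0 ≤ s → ∀ x, Tendsto (fun n : ℕ => w n ⌈s * (n + 1)⌉₊ x) atTop (𝓝 (u s x))) ∧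
      ∀ D : Set (X → ℝ), (∀ v, (∀ E, IsExhaustion E → v ∈ G.Omega p (absorption q) E) → v ∈ D) →
        G.IsMildSolution p (absorption q) D 0 u₀ u := by
  classical
  have hp0 : 0 < p := by linarith
  have : Fact (1 ≤ ENNReal.ofReal p) := ⟨by simpa using ENNReal.ofReal_le_ofReal hp⟩
  have hr : ∀ (l : ℝ) (g : X → ℝ), ∃ u, 0 < l → g ∈ G.admissible p → u ∈ G.admissible p ∧
      G.IsMinimalResolvent q l g u ∧ (∀ E, IsExhaustion E → u ∈ G.Omega p (absorption q) E) ∧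
      u + l • G.opA (absorption q) u = g := by
    intro l g
    by_cases h : 0 < l ∧ g ∈ G.admissible p
    · obtain ⟨u, hu⟩ := exists_isMinimalResolvent hp hq h.1 h.2
      exact ⟨u, fun _ _ => hu⟩
    · exact ⟨0, fun h1 h2 => absurd ⟨h1, h2⟩ h⟩
  choose r hr using hr
  choose ofLp hofm hof using G.exists_toLp_eq hp0
  -- Working in the intersection over all exhaustions makes the constructed solution independent of
  -- any one of them.
  let O : Set (X → ℝ) := {v | ∀ E, IsExhaustion E → v ∈ G.Omega p (absorption q) E}
  have hA : IsAccretive (G.graphOn p (absorption q) O) := by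
    obtain ⟨E, hE⟩ := exists_isExhaustion (X := X)
    exact (G.isAccretive_omega hp (antitone_absorption hq) E).mono
      (Set.image_mono fun v hv => hv E hE)
  have hO : ∀ v ∈ O, v ∈ G.domA p (absorption q) := by
    obtain ⟨E, hE⟩ := exists_isExhaustion (X := X)
    exact fun v hv => (hv E hE).1
  let R : ℝ → lp (fun _ : X => ℝ) (ENNReal.ofReal p) → lp (fun _ : X => ℝ) (ENNReal.ofReal p) :=
    fun l b => G.toLp p (r l (ofLp b))
  have hinv : ∀ g ∈ G.admissible p, ofLp (G.toLp p g) = g := fun g hg =>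
    (hofm _).toLp_inj hp0 hg.2.2 (hof _)
  have hR : ∀ l > 0, ∀ b ∈ G.toLp p '' G.admissible p, R l b ∈ G.toLp p '' G.admissible p ∧
      ∃ y, (R l b, y) ∈ G.graphOn p (absorption q) O ∧ R l b + l • y = b := by
    rintro l hl _ ⟨g, hg, rfl⟩
    obtain ⟨h1, -, h3, h4⟩ := hr l g hl hg
    simp only [R, hinv g hg]
    have h5 := hO _ h3
    refine ⟨⟨_, h1, rfl⟩, G.toLp p (G.opA (absorption q) (r l g)), ⟨_, h3, rfl⟩, ?_⟩
    rw [← h5.2.2.toLp_smul hp0, ← h5.1.toLp_add hp0 (h5.2.2.smul hp0 l), h4]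
  let w : ℕ → ℕ → X → ℝ := fun n k => (r (1 / ((n : ℝ) + 1)))^[k] u₀
  have hpos : ∀ n : ℕ, (0 : ℝ) < 1 / ((n : ℝ) + 1) := fun n => by positivity
  have hwsucc : ∀ n k, w n (k + 1) = r (1 / ((n : ℝ) + 1)) (w n k) := fun n k =>
    Function.iterate_succ_apply' _ _ _
  have hw : ∀ n k, w n k ∈ G.admissible p := by
    intro n k
    induction k with
    | zero => exact hu₀
    | succ k ih => rw [hwsucc]; exact (hr _ _ (hpos n) ih).1
  have hwR : ∀ (n k : ℕ), (R (1 / ((n : ℝ) + 1)))^[k] (G.toLp p u₀) = G.toLp p (w n k) := by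
    intro n k
    induction k with
    | zero => rfl
    | succ k ih => rw [Function.iterate_succ_apply', ih, hwsucc]; simp only [R, hinv _ (hw n k)]
  have hcl : G.toLp p u₀ ∈ closure (Prod.fst '' G.graphOn p (absorption q) O) := by
    rw [Metric.mem_closure_iff]
    intro e he
    obtain ⟨z, hz, hze⟩ := exists_omega_ellpNorm_lt hp hC (absorption_zero q) hu₀.2.2 he
    refine ⟨_, ⟨_, ⟨z, hz, rfl⟩, rfl⟩, ?_⟩
    rwa [dist_eq_norm, hu₀.2.2.norm_toLp_sub hp0 (hO z hz).1]
  obtain ⟨U, hU, hUc⟩ := exists_tendstoUniformlyOn_eulerApprox hA hR ⟨u₀, hu₀, rfl⟩ hcl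
  have hE : ∀ (n : ℕ) (s : ℝ), eulerApprox R (G.toLp p u₀) n s
      = G.toLp p (w n ⌈s * (n + 1)⌉₊) := fun n s => hwR n _
  refine ⟨fun s => ofLp (U s), w, fun n => rfl, fun n k => ?_, fun s hs x => ?_, fun D hD a ha =>
    ⟨fun s _ => hofm _, fun s hs => ?_, fun e he => ?_⟩⟩
  · rw [hwsucc]; exact (hr _ _ (hpos n) (hw n k)).2.1
  · refine tendsto_apply_of_tendsto_toLp hp (fun n => (hw n _).2.2) (hofm _) ?_ x
    rw [hof]
    exact ((hU s).tendsto_at ⟨hs, le_rfl⟩).congr fun n => hE n s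
  · simp only [← (hofm _).norm_toLp_sub hp0 (hofm _), hof]
    rw [← tendsto_iff_norm_sub_tendsto_zero]
    exact hUc a s hs
  · have h1 := Metric.tendstoUniformlyOn_iff.1 (hU a) e he
    have h2 := tendsto_one_div_add_atTop_nhds_zero_nat (𝕜 := ℝ) |>.eventually (gt_mem_nhds he)
    obtain ⟨n, hn1, hn2⟩ := (h1.and h2).exists
    have hp1 : (0 : ℝ) < (n : ℝ) + 1 := by positivity
    have hlt : ∀ k < ⌊a * ((n : ℝ) + 1)⌋₊, (k : ℝ) * (1 / ((n : ℝ) + 1))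
        < ((k + 1 : ℕ) : ℝ) * (1 / ((n : ℝ) + 1)) := fun k _ => by
      push_cast; linarith [hpos n]
    have hstep : ∀ k : ℕ, ((k + 1 : ℕ) : ℝ) * (1 / ((n : ℝ) + 1)) - k * (1 / ((n : ℝ) + 1))
        = 1 / ((n : ℝ) + 1) := fun k => by push_cast; ring
    have hz : G.ellpNorm p (0 : X → ℝ) = 0 := by
      simp [ellpNorm, Real.zero_rpow hp0.ne', Real.zero_rpow (inv_pos.2 hp0).ne']
    have hta : (⌊a * ((n : ℝ) + 1)⌋₊ : ℝ) * (1 / ((n : ℝ) + 1)) ≤ a := by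
      rw [mul_one_div, div_le_iff₀ hp1]; exact Nat.floor_le (by positivity)
    -- The uniform grid keeps as many full steps as fit into `[0, a]`, so the remainder is shorter
    -- than one step; there are no error terms.
    refine ⟨⌊a * ((n : ℝ) + 1)⌋₊, fun k => k * (1 / ((n : ℝ) + 1)), 0, w n,
      ⟨by simp, hlt, hta, fun k _ => (hstep k).trans_le hn2.le, ?_, fun k _ => ?_, fun k _ => ?_,
        ?_⟩, ⟨rfl, fun k _ => ⟨?_, fun x => ?_⟩⟩, fun s hs => ?_⟩
    · have := Nat.lt_floor_add_one (a * ((n : ℝ) + 1))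
      have h3 : a ≤ ((⌊a * ((n : ℝ) + 1)⌋₊ : ℝ) + 1) * (1 / ((n : ℝ) + 1)) := by
        rw [mul_one_div, le_div_iff₀ hp1]; exact this.le
      linarith
    · exact memEllp_of_support_subset hp0 (E := ∅) (by simp)
    · simp [hz]
    · simp [hz, he.le]
    · rw [hwsucc]; exact hD _ (hr _ _ (hpos n) (hw n k)).2.2.1
    · have h4 := congrFun (hr _ _ (hpos n) (hw n k)).2.2.2 x
      simp only [hstep, Pi.zero_apply, mul_zero, add_zero]
      rw [hwsucc]; exact h4
    · have hsa : s ∈ Set.Icc 0 a := ⟨hs.1, hs.2.trans hta⟩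
      have h5 : stepFun ⌊a * ((n : ℝ) + 1)⌋₊ (fun k => k * (1 / ((n : ℝ) + 1))) (w n) s
          = w n ⌈s * (n + 1)⌉₊ := by
        rcases hs.1.eq_or_lt with h | h
        · rw [← h, stepFun_zero]; simp
        · obtain ⟨k, hk, hks⟩ := exists_mem_Ioc_of_partition
            (t := fun k : ℕ => (k : ℝ) * (1 / ((n : ℝ) + 1))) (by simp) h hs.2
          rw [stepFun_of_mem_Ioc (by simp) hlt (w n) hk hks]
          congr 1
          symm
          obtain ⟨k1, k2⟩ := hks
          rw [mul_one_div, div_lt_iff₀ hp1] at k1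
          rw [mul_one_div, le_div_iff₀ hp1] at k2
          rw [Nat.ceil_eq_iff (by omega)]
          exact ⟨by simpa using k1, k2⟩
      have h6 := hn1 s hsa
      rw [hE, dist_eq_norm, ← hof (U s), (hofm _).norm_toLp_sub hp0 (hw n _).2.2] at h6
      rw [h5]; exact h6

end WeightedGraph

/-! ### The implicit Euler scheme for `z' = -z ^ q`. -/

section ScalarEuler

/-- Tangent line inequality for `s ↦ s ^ c`, `c ≤ 0`. -/
theorem one_add_mul_le_rpow_of_nonpos {r c : ℝ} (hr : 0 < r) (hc : c ≤ 0) :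
    1 + c * (r - 1) ≤ r ^ c := by
  rw [Real.rpow_def_of_pos hr]
  have h1 := Real.add_one_le_exp (Real.log r * c)
  have h2 := mul_le_mul_of_nonpos_right (Real.log_le_sub_one_of_pos hr) hc
  linarith

theorem rpow_le_one_add_mul {r c : ℝ} (hr : 0 < r) (hc0 : 0 ≤ c) (hc1 : c ≤ 1) :
    r ^ c ≤ 1 + c * (r - 1) := by
  have := rpow_one_add_le_one_add_mul_self (s := r - 1) (by linarith) hc0 hc1
  rwa [add_sub_cancel] at this

/-- Discrete form of `(z^(1-q))' = -(1-q)`: with `ρ = a / b = 1 + l * b ^ (q - 1)`, the defect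
against the exact flow is a factor `ρ ^ (-q)`, close to `1` when `l * b ^ (q - 1)` is small. -/
theorem implicit_step_identity {q l a b : ℝ} (hl : 0 ≤ l) (hb : 0 < b)
    (h : b + l * b ^ q = a) :
    0 < a ∧ a ^ (1 - q) * (1 - b / a) = l * (1 + l * b ^ (q - 1)) ^ (-q) := by
  have hbq : b ^ q = b * b ^ (q - 1) := by
    rw [Real.rpow_sub_one hb.ne']; field_simp
  set ρ := 1 + l * b ^ (q - 1) with hρ
  have hρ0 : 0 < ρ := by
    have := mul_nonneg hl (Real.rpow_nonneg hb.le (q - 1))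
    linarith
  have haρ : a = b * ρ := by rw [← h, hbq, hρ]; ring
  have ha : 0 < a := by rw [haρ]; positivity
  refine ⟨ha, ?_⟩
  have h1 : 1 - b / a = l * b ^ q / a := by
    rw [← h] at ha ⊢; field_simp; ring
  rw [h1, Real.rpow_sub ha, Real.rpow_one]
  have h2 : a ^ q = b ^ q * ρ ^ q := by rw [haρ, Real.mul_rpow hb.le hρ0.le]
  have h3 : 0 < b ^ q := Real.rpow_pos_of_pos hb q
  have h4 : 0 < ρ ^ q := Real.rpow_pos_of_pos hρ0 q
  rw [h2, Real.rpow_neg hρ0.le]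
  field_simp

theorem implicit_step_of_one_lt {q l a b M : ℝ} (hq : 1 < q) (hl : 0 ≤ l) (hb : 0 < b)
    (hbM : b ≤ M) (h : b + l * b ^ q = a) :
    a ^ (1 - q) + (q - 1) * (l * (1 + l * M ^ (q - 1)) ^ (-q)) ≤ b ^ (1 - q) := by
  obtain ⟨ha, e⟩ := implicit_step_identity hl hb h
  have hba : b ^ (1 - q) = a ^ (1 - q) * (b / a) ^ (1 - q) := by
    rw [Real.div_rpow hb.le ha.le]; field_simp
  have h1 := mul_le_mul_of_nonneg_left
    (one_add_mul_le_rpow_of_nonpos (div_pos hb ha) (show 1 - q ≤ 0 by linarith))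
    (Real.rpow_nonneg ha.le (1 - q))
  have h2 : (1 + l * M ^ (q - 1)) ^ (-q) ≤ (1 + l * b ^ (q - 1)) ^ (-q) := by
    have h3 := Real.rpow_nonneg hb.le (q - 1)
    refine Real.rpow_le_rpow_of_nonpos (by positivity) ?_ (by linarith)
    have := mul_le_mul_of_nonneg_left
      (Real.rpow_le_rpow hb.le hbM (show 0 ≤ q - 1 by linarith)) hl
    linarith
  have h4 := mul_le_mul_of_nonneg_left (mul_le_mul_of_nonneg_left h2 hl)
    (show 0 ≤ q - 1 by linarith)
  rw [hba]
  have e' : a ^ (1 - q) * (1 + (1 - q) * (b / a - 1))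
      = a ^ (1 - q) + (q - 1) * (a ^ (1 - q) * (1 - b / a)) := by ring
  rw [e', e] at h1
  linarith

/-- The threshold `d` is needed because `b ^ (q - 1)` blows up as `b → 0`. -/
theorem implicit_step_of_lt_one {q l a b d : ℝ} (hq0 : 0 < q) (hq : q < 1) (hl : 0 ≤ l)
    (hd : 0 < d) (hdb : d ≤ b) (h : b + l * b ^ q = a) :
    b ^ (1 - q) ≤ a ^ (1 - q) - (1 - q) * (l * (1 + l * d ^ (q - 1)) ^ (-q)) := by
  have hb : 0 < b := hd.trans_le hdb
  obtain ⟨ha, e⟩ := implicit_step_identity hl hb h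
  have hba : b ^ (1 - q) = a ^ (1 - q) * (b / a) ^ (1 - q) := by
    rw [Real.div_rpow hb.le ha.le]; field_simp
  have h1 := mul_le_mul_of_nonneg_left
    (rpow_le_one_add_mul (div_pos hb ha) (show 0 ≤ 1 - q by linarith) (by linarith))
    (Real.rpow_nonneg ha.le (1 - q))
  have h2 : (1 + l * d ^ (q - 1)) ^ (-q) ≤ (1 + l * b ^ (q - 1)) ^ (-q) := by
    have h3 := Real.rpow_nonneg hb.le (q - 1)
    refine Real.rpow_le_rpow_of_nonpos (by positivity) ?_ (by linarith)
    have := mul_le_mul_of_nonneg_left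
      (Real.rpow_le_rpow_of_nonpos hd hdb (show q - 1 ≤ 0 by linarith)) hl
    linarith
  have h4 := mul_le_mul_of_nonneg_left (mul_le_mul_of_nonneg_left h2 hl)
    (show 0 ≤ 1 - q by linarith)
  rw [hba]
  have e' : a ^ (1 - q) * (1 + (1 - q) * (b / a - 1))
      = a ^ (1 - q) - (1 - q) * (a ^ (1 - q) * (1 - b / a)) := by ring
  rw [e', e] at h1
  linarith

/-- An implicit Euler sequence of step size `l` for `z' = -z ^ q` that starts at `M`. -/
structure IsScalarEuler (q l M : ℝ) (z : ℕ → ℝ) : Prop where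
  zero : z 0 = M
  nonneg : ∀ k, 0 ≤ z k
  step : ∀ k, z (k + 1) + l * z (k + 1) ^ q = z k

theorem exists_isScalarEuler {q l M : ℝ} (hq : 0 < q) (hl : 0 ≤ l) (hM : 0 ≤ M) :
    ∃ z, IsScalarEuler q l M z := by
  have hex : ∀ s : ℝ, ∃ r, 0 ≤ s → 0 ≤ r ∧ 1 * r + l * r ^ q = s := fun s => by
    by_cases hs : 0 ≤ s
    · obtain ⟨r, hr⟩ := exists_nonneg_add_rpow_eq le_rfl hl hq hs
      exact ⟨r, fun _ => hr⟩
    · exact ⟨0, fun h => absurd h hs⟩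
  choose ζ hζ using hex
  have h0 : ∀ k, 0 ≤ ζ^[k] M := by
    intro k
    induction k with
    | zero => exact hM
    | succ k ih => rw [Function.iterate_succ_apply']; exact (hζ _ ih).1
  refine ⟨fun k => ζ^[k] M, rfl, h0, fun k => ?_⟩
  have := (hζ _ (h0 k)).2
  rw [one_mul] at this
  simpa only [Function.iterate_succ_apply'] using this

variable {q l M : ℝ} {z : ℕ → ℝ}

theorem IsScalarEuler.succ_le (H : IsScalarEuler q l M z) (hl : 0 ≤ l) (k : ℕ) :
    z (k + 1) ≤ z k := by
  have := H.step k
  have := mul_nonneg hl (Real.rpow_nonneg (H.nonneg (k + 1)) q)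
  linarith

theorem IsScalarEuler.le (H : IsScalarEuler q l M z) (hl : 0 ≤ l) (k : ℕ) : z k ≤ M := by
  induction k with
  | zero => exact H.zero.le
  | succ k ih => exact (H.succ_le hl k).trans ih

theorem IsScalarEuler.pos (H : IsScalarEuler q l M z) (hq : 0 < q) (hM : 0 < M) (k : ℕ) :
    0 < z k := by
  induction k with
  | zero => rw [H.zero]; exact hM
  | succ k ih =>
    refine (H.nonneg (k + 1)).lt_of_ne fun h => ?_
    have := H.step k
    rw [← h, Real.zero_rpow hq.ne'] at this
    linarith

theorem IsScalarEuler.le_of_one_lt (H : IsScalarEuler q l M z) (hq : 1 < q) (hl : 0 ≤ l)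
    (hM : 0 < M) {s : ℝ} (hs : 0 ≤ s) {k : ℕ} (hk : s ≤ k * l) :
    z k ≤ (1 / M ^ (q - 1) + (q - 1) * (s * (1 + l * M ^ (q - 1)) ^ (-q))) ^ (-(1 / (q - 1))) := by
  have hq1 : 0 < q - 1 := by linarith
  set θ := (1 + l * M ^ (q - 1)) ^ (-q)
  have hMq : 0 < M ^ (q - 1) := Real.rpow_pos_of_pos hM _
  have hθ : 0 ≤ θ := Real.rpow_nonneg (by positivity) _
  have key : ∀ k : ℕ, 1 / M ^ (q - 1) + (q - 1) * (k * l * θ) ≤ z k ^ (1 - q) := by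
    intro k
    induction k with
    | zero =>
      rw [H.zero, one_div, ← Real.rpow_neg hM.le, neg_sub]
      simp
    | succ k ih =>
      have := implicit_step_of_one_lt hq hl (H.pos (by linarith) hM (k + 1)) (H.le hl (k + 1))
        (H.step k)
      push_cast
      linarith
  have hz := H.pos (by linarith : 0 < q) hM k
  have h1 : 1 / M ^ (q - 1) + (q - 1) * (s * θ) ≤ z k ^ (1 - q) :=
    le_trans (by gcongr) (key k)
  have h2 : z k = (z k ^ (1 - q)) ^ (-(1 / (q - 1))) := by
    rw [← Real.rpow_mul hz.le]
    have : (1 - q) * -(1 / (q - 1)) = 1 := by field_simp; ring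
    rw [this, Real.rpow_one]
  rw [h2]
  exact Real.rpow_le_rpow_of_nonpos (by positivity) h1 (by rw [neg_nonpos]; positivity)

/-- The sequence decreases, so a value above `d` means that all earlier ones were above `d` and the
step estimate accumulates. -/
theorem IsScalarEuler.le_of_lt_one (H : IsScalarEuler q l M z) (hq0 : 0 < q) (hq : q < 1)
    (hl : 0 ≤ l) {d : ℝ} (hd : 0 < d) {s : ℝ} {k : ℕ} (hk : s ≤ k * l) :
    z k ≤ max d ((max (M ^ (1 - q) - (1 - q) * (s * (1 + l * d ^ (q - 1)) ^ (-q))) 0)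
      ^ (1 / (1 - q))) := by
  have hq1 : 0 < 1 - q := by linarith
  set θ := (1 + l * d ^ (q - 1)) ^ (-q)
  have hdq : 0 < d ^ (q - 1) := Real.rpow_pos_of_pos hd _
  have hθ : 0 ≤ θ := Real.rpow_nonneg (by positivity) _
  have key : ∀ k : ℕ, d < z k → z k ^ (1 - q) ≤ M ^ (1 - q) - (1 - q) * (k * l * θ) := by
    intro k
    induction k with
    | zero => intro _; rw [H.zero]; simp
    | succ k ih =>
      intro hdz
      have h1 := ih (hdz.trans_le (H.succ_le hl k))
      have h2 := implicit_step_of_lt_one hq0 hq hl hd hdz.le (H.step k)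
      push_cast
      linarith
  rcases le_or_gt (z k) d with h | h
  · exact h.trans (le_max_left _ _)
  · refine le_trans ?_ (le_max_right _ _)
    have hz := H.nonneg k
    have h2 : z k = (z k ^ (1 - q)) ^ (1 / (1 - q)) := by
      rw [← Real.rpow_mul hz, mul_one_div_cancel hq1.ne', Real.rpow_one]
    rw [h2]
    refine Real.rpow_le_rpow (Real.rpow_nonneg hz _) (le_trans (key k h) ?_) (by positivity)
    refine le_trans ?_ (le_max_left _ _)
    gcongr

theorem tendsto_rpow_euler_factor (c q : ℝ) :
    Tendsto (fun n : ℕ => (1 + 1 / ((n : ℝ) + 1) * c) ^ (-q)) atTop (𝓝 1) := by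
  have h1 := ((tendsto_one_div_add_atTop_nhds_zero_nat (𝕜 := ℝ)).mul_const c).const_add 1
  have h2 := h1.rpow_const (p := -q) (Or.inl (by simp))
  simpa using h2

end ScalarEuler

theorem le_ceil_mul_one_div (n : ℕ) (s : ℝ) :
    s ≤ (⌈s * ((n : ℝ) + 1)⌉₊ : ℝ) * (1 / ((n : ℝ) + 1)) := by
  rw [mul_one_div, le_div_iff₀ (by positivity)]
  exact Nat.le_ceil _

theorem ceil_mul_one_div_le (n : ℕ) {s : ℝ} (hs : 0 ≤ s) :
    (⌈s * ((n : ℝ) + 1)⌉₊ : ℝ) * (1 / ((n : ℝ) + 1)) ≤ s + 1 := by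
  have h1 := (Nat.ceil_lt_add_one (a := s * ((n : ℝ) + 1)) (by positivity)).le
  have h2 : (0 : ℝ) ≤ n := n.cast_nonneg
  rw [mul_one_div, div_le_iff₀ (by positivity)]
  linarith

/-! ### Barriers and strict positivity for the limit of the schemes. -/

namespace WeightedGraph

variable {X : Type*} {G : WeightedGraph X} {q M : ℝ} {u₀ : X → ℝ}
  {w : ℕ → ℕ → X → ℝ}

/-- The constant `z (k + 1)` is a supersolution for every right-hand side below `z k`, and the
resolvent is minimal. -/
theorem IsMinimalResolvent.le_scalarEuler {l : ℝ} (hl : 0 ≤ l) {w : ℕ → X → ℝ} {z : ℕ → ℝ}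
    (hz : IsScalarEuler q l M z) (hu₀ : ∀ x, w 0 x ≤ M)
    (hw : ∀ k, G.IsMinimalResolvent q l (w k) (w (k + 1))) (k : ℕ) (x : X) : w k x ≤ z k := by
  induction k generalizing x with
  | zero => rw [hz.zero]; exact hu₀ x
  | succ k ih =>
    exact (hw k).le _ (isSupersolution_const hl (hz.nonneg _)
      (fun x => by rw [hz.step]; exact ih x) _) x

theorem le_barrier_of_one_lt (hq : 1 < q) (hM : 0 < M) (hw0 : ∀ n x, w n 0 x ≤ M)
    (hw : ∀ (n : ℕ) k, G.IsMinimalResolvent q (1 / ((n : ℝ) + 1)) (w n k) (w n (k + 1)))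
    {s : ℝ} (hs : 0 ≤ s) {x : X} {a : ℝ}
    (hlim : Tendsto (fun n : ℕ => w n ⌈s * (n + 1)⌉₊ x) atTop (𝓝 a)) :
    a ≤ (1 / M ^ (q - 1) + (q - 1) * s) ^ (-(1 / (q - 1))) := by
  have hl : ∀ n : ℕ, 0 ≤ 1 / ((n : ℝ) + 1) := fun n => by positivity
  choose z hz using fun n : ℕ =>
    exists_isScalarEuler (q := q) (l := 1 / ((n : ℝ) + 1)) (by linarith) (hl n) hM.le
  have hMq : 0 < M ^ (q - 1) := Real.rpow_pos_of_pos hM _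
  have hq1 : 0 < q - 1 := by linarith
  have h1 : Tendsto (fun n : ℕ => (1 / M ^ (q - 1) + (q - 1) * (s * (1 + 1 / ((n : ℝ) + 1)
      * M ^ (q - 1)) ^ (-q))) ^ (-(1 / (q - 1)))) atTop
      (𝓝 ((1 / M ^ (q - 1) + (q - 1) * (s * 1)) ^ (-(1 / (q - 1))))) := by
    refine Tendsto.rpow_const ?_ (Or.inl ?_)
    · exact (((tendsto_rpow_euler_factor (M ^ (q - 1)) q).const_mul s).const_mul _).const_add _
    · positivity
  rw [mul_one] at h1
  refine le_of_tendsto_of_tendsto' hlim h1 fun n => ?_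
  exact (IsMinimalResolvent.le_scalarEuler (hl n) (hz n) (hw0 n) (hw n) _ x).trans
    ((hz n).le_of_one_lt hq (hl n) hM hs (le_ceil_mul_one_div n s))

theorem le_barrier_of_lt_one (hq0 : 0 < q) (hq : q < 1) (hM : 0 ≤ M) (hw0 : ∀ n x, w n 0 x ≤ M)
    (hw : ∀ (n : ℕ) k, G.IsMinimalResolvent q (1 / ((n : ℝ) + 1)) (w n k) (w n (k + 1)))
    {s : ℝ} {x : X} {a : ℝ}
    (hlim : Tendsto (fun n : ℕ => w n ⌈s * (n + 1)⌉₊ x) atTop (𝓝 a)) :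
    a ≤ (max (M ^ (1 - q) - (1 - q) * s) 0) ^ (1 / (1 - q)) := by
  have hl : ∀ n : ℕ, 0 ≤ 1 / ((n : ℝ) + 1) := fun n => by positivity
  choose z hz using fun n : ℕ =>
    exists_isScalarEuler (q := q) (l := 1 / ((n : ℝ) + 1)) hq0 (hl n) hM
  have hq1 : 0 < 1 - q := by linarith
  set A := (max (M ^ (1 - q) - (1 - q) * s) 0) ^ (1 / (1 - q))
  have hA : 0 ≤ A := Real.rpow_nonneg (le_max_right _ _) _
  -- The step size tends to zero with the threshold `d` fixed; `d` is removed afterwards.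
  refine le_of_forall_pos_le_add fun d hd => ?_
  have h1 : Tendsto (fun n : ℕ => max d ((max (M ^ (1 - q) - (1 - q) * (s * (1 + 1 / ((n : ℝ) + 1)
      * d ^ (q - 1)) ^ (-q))) 0) ^ (1 / (1 - q)))) atTop
      (𝓝 (max d ((max (M ^ (1 - q) - (1 - q) * (s * 1)) 0) ^ (1 / (1 - q))))) := by
    refine Tendsto.max tendsto_const_nhds (Tendsto.rpow_const ?_ (Or.inr (by positivity)))
    exact ((((tendsto_rpow_euler_factor (d ^ (q - 1)) q).const_mul s).const_mul _).const_sub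
      _).max tendsto_const_nhds
  rw [mul_one] at h1
  have h2 : a ≤ max d A := by
    refine le_of_tendsto_of_tendsto' hlim h1 fun n => ?_
    exact (IsMinimalResolvent.le_scalarEuler (hl n) (hz n) (hw0 n) (hw n) _ x).trans
      ((hz n).le_of_lt_one hq0 hq (hl n) hd (le_ceil_mul_one_div n s))
  exact h2.trans (max_le (by linarith) (by linarith))

/-- All neighbours but `y` are discarded, and `v ^ q ≤ M ^ (q - 1) * v` makes the absorption linear;
this is where `q > 1` enters. -/
theorem IsMinimalResolvent.lower_bound (hq : 1 < q) {l : ℝ} (hl : 0 ≤ l) {g v : X → ℝ}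
    (hM : ∀ x, v x ≤ M) (hv : G.IsMinimalResolvent q l g v) (x y : X) :
    g x + l * (G.w x y * v y / G.μ x) ≤
      (1 + l * ((∑' y, G.w x y + G.κ x) / G.μ x + M ^ (q - 1))) * v x := by
  have h1 := hv.eq x
  have hμ := G.μ_pos x
  have h2 : G.w x y * v y ≤ ∑' y, G.w x y * v y :=
    (summable_of_bounded hv.nonneg hM x).le_tsum y
      fun z _ => mul_nonneg (G.w_nonneg x z) (hv.nonneg z)
  have h3 := mul_le_mul_of_nonneg_left h2 (div_nonneg hl hμ.le)
  have h4 : v x ^ q ≤ M ^ (q - 1) * v x := by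
    rcases (hv.nonneg x).eq_or_lt with h | h
    · rw [← h, Real.zero_rpow (by linarith), mul_zero]
    · have e : v x ^ q = v x ^ (q - 1) * v x := by
        rw [Real.rpow_sub_one h.ne']; field_simp
      rw [e]
      exact mul_le_mul_of_nonneg_right
        (Real.rpow_le_rpow h.le (hM x) (by linarith)) h.le
  have h5 := mul_le_mul_of_nonneg_left h4 hl
  have e1 : l * (G.w x y * v y / G.μ x) = l / G.μ x * (G.w x y * v y) := by ring
  have e2 : (1 + l * ((∑' y, G.w x y + G.κ x) / G.μ x + M ^ (q - 1))) * v x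
      = G.diagCoeff l x * v x + l * (M ^ (q - 1) * v x) := by rw [diagCoeff]; ring
  rw [e1, e2]
  linarith

/-- Strict positivity of the limit of the Euler approximations. -/
theorem pos_of_one_lt (hG : G.IsConnected) (hq : 1 < q) (hM : 0 < M) (hw0 : ∀ n, w n 0 = u₀)
    (hu₀ : ∀ x, 0 ≤ u₀ x) (hu₀M : ∀ x, u₀ x ≤ M)
    (hw : ∀ (n : ℕ) k, G.IsMinimalResolvent q (1 / ((n : ℝ) + 1)) (w n k) (w n (k + 1)))
    (hne : ∃ x, u₀ x ≠ 0) {s : ℝ} (hs : 0 < s) {x : X} {a : ℝ}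
    (hlim : Tendsto (fun n : ℕ => w n ⌈s * (n + 1)⌉₊ x) atTop (𝓝 a)) : 0 < a := by
  have hl : ∀ n : ℕ, 0 < 1 / ((n : ℝ) + 1) := fun n => by positivity
  have hMq : 0 < M ^ (q - 1) := Real.rpow_pos_of_pos hM _
  have hwM : ∀ n k x, w n k x ≤ M := by
    intro n k x
    obtain ⟨z, hz⟩ := exists_isScalarEuler (q := q) (l := 1 / ((n : ℝ) + 1)) (by linarith)
      (hl n).le hM.le
    exact (IsMinimalResolvent.le_scalarEuler (hl n).le hz
      (fun x => by rw [hw0]; exact hu₀M x) (hw n) k x).trans (hz.le (hl n).le k)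
  have hwnn : ∀ n k x, 0 ≤ w n k x := by
    rintro n (_ | k) x
    · rw [hw0]; exact hu₀ x
    · exact (hw n k).nonneg x
  let C : X → ℝ := fun x => (∑' y, G.w x y + G.κ x) / G.μ x + M ^ (q - 1)
  have hC : ∀ x, 0 < C x := fun x => by
    have h1 : 0 ≤ ∑' y, G.w x y := tsum_nonneg fun y => G.w_nonneg x y
    have h2 := G.κ_nonneg x
    have h3 := G.μ_pos x
    positivity
  have hlb : ∀ (n k : ℕ) x y, w n k x + 1 / ((n : ℝ) + 1) * (G.w x y * w n (k + 1) y / G.μ x)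
      ≤ (1 + 1 / ((n : ℝ) + 1) * C x) * w n (k + 1) x := fun n k x y =>
    (hw n k).lower_bound hq (hl n).le (hwM n (k + 1)) x y
  -- A lower bound uniform in the step size on each time window `[s, T]`, strong enough to survive
  -- the limit and to be propagated along a walk.
  let Q : X → Prop := fun x => ∀ s > 0, ∀ T > 0, ∃ c > 0, ∀ᶠ n : ℕ in atTop, ∀ k : ℕ,
    s ≤ k * (1 / ((n : ℝ) + 1)) → k * (1 / ((n : ℝ) + 1)) ≤ T → c ≤ w n k x
  suffices hQ : Q x by
    obtain ⟨c, hc, hev⟩ := hQ s hs (s + 1) (by linarith)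
    refine hc.trans_le (ge_of_tendsto hlim ?_)
    filter_upwards [hev] with n hn
    exact hn _ (le_ceil_mul_one_div n s) (ceil_mul_one_div_le n hs.le)
  clear hlim
  obtain ⟨x₀, hx₀⟩ := hne
  have hx₀ : 0 < u₀ x₀ := (hu₀ x₀).lt_of_ne (Ne.symm hx₀)
  induction hG x₀ x with
  | refl =>
    intro s hs T hT
    -- At the starting node the inflow is ignored, and linear decay at rate `C x₀` remains.
    refine ⟨u₀ x₀ * Real.exp (-(C x₀ * T)), by positivity, Eventually.of_forall fun n k _ hkT => ?_⟩
    have key : ∀ k : ℕ, u₀ x₀ * Real.exp (-(C x₀ * (k * (1 / ((n : ℝ) + 1))))) ≤ w n k x₀ := by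
      intro k
      induction k with
      | zero => simp [hw0]
      | succ k ih =>
        have h1 := hlb n k x₀ x₀
        rw [G.w_self, zero_mul, zero_div, mul_zero, add_zero] at h1
        have h2 : 1 + 1 / ((n : ℝ) + 1) * C x₀ ≤ Real.exp (C x₀ * (1 / ((n : ℝ) + 1))) := by
          have := Real.add_one_le_exp (C x₀ * (1 / ((n : ℝ) + 1)))
          linarith
        have h3 := ih.trans (h1.trans (mul_le_mul_of_nonneg_right h2 (hwnn n (k + 1) x₀)))
        have e : Real.exp (-(C x₀ * (k * (1 / ((n : ℝ) + 1)))))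
            = Real.exp (C x₀ * (1 / ((n : ℝ) + 1)))
              * Real.exp (-(C x₀ * ((k + 1 : ℕ) * (1 / ((n : ℝ) + 1))))) := by
          rw [← Real.exp_add]; congr 1; push_cast; ring
        rw [e] at h3
        refine le_of_mul_le_mul_left ?_ (Real.exp_pos (C x₀ * (1 / ((n : ℝ) + 1))))
        linarith
    refine le_trans ?_ (key k)
    have := mul_le_mul_of_nonneg_left hkT (hC x₀).le
    gcongr
  | @tail y x _ hyx ih =>
    intro s hs T hT
    obtain ⟨c, hc, hev⟩ := ih (s / 2) (by positivity) T hT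
    have hwxy : 0 < G.w x y := by
      rw [G.w_symm]; exact (G.w_nonneg y x).lt_of_ne (Ne.symm hyx)
    have hμ := G.μ_pos x
    set b := G.w x y * c / G.μ x with hb_def
    have hb : 0 < b := by positivity
    have hCx := hC x
    -- `b` bounds the inflow from `y` below on `[s/2, T]`. This slope makes the linear ramp starting
    -- near time `s / 2` a discrete subsolution up to time `T`, despite the loss at rate `C x`.
    set β := b / (1 + C x * T) with hβ_def
    have hβ : 0 < β := by positivity
    have hβe : β * (1 + C x * T) = b := by rw [hβ_def]; field_simp
    refine ⟨β * (s / 4), by positivity, ?_⟩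
    have hsmall := (tendsto_one_div_add_atTop_nhds_zero_nat (𝕜 := ℝ)).eventually
      (gt_mem_nhds (show 0 < s / 4 by positivity))
    filter_upwards [hev, hsmall] with n hn hns k hsk hkT
    set l := 1 / ((n : ℝ) + 1) with hl_def
    have hln : 0 < l := hl n
    -- The delay by `l` makes the ramp at step `k + 1` equal to `β * (k * l - s / 2)`, which closes
    -- the implicit step. From time `s` on, `l < s / 4` leaves at least `β * (s / 4)`.
    have key : ∀ k : ℕ, k * l ≤ T → β * (k * l - s / 2 - l) ≤ w n k x := by
      intro k
      induction k with
      | zero =>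
        intro _
        refine le_trans ?_ (hwnn n 0 x)
        refine mul_nonpos_of_nonneg_of_nonpos hβ.le ?_
        push_cast; linarith
      | succ k ihk =>
        intro hkT
        have hk1 : ((k + 1 : ℕ) : ℝ) * l = k * l + l := by push_cast; ring
        rw [hk1] at hkT ⊢
        have h1 := ihk (by linarith)
        rcases le_or_gt (k * l + l) (s / 2) with hJ | hJ
        · refine le_trans ?_ (hwnn n (k + 1) x)
          exact mul_nonpos_of_nonneg_of_nonpos hβ.le (by linarith)
        · have h2 := hn (k + 1) (by rw [hk1]; exact hJ.le) (by rw [hk1]; exact hkT)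
          have h3 := hlb n k x y
          have h4 : b ≤ G.w x y * w n (k + 1) y / G.μ x := by
            rw [hb_def]; gcongr
          have h5 := mul_le_mul_of_nonneg_left h4 hln.le
          have h6 : β * (1 + C x * (k * l - s / 2)) ≤ b := by
            rw [← hβe]
            refine mul_le_mul_of_nonneg_left ?_ hβ.le
            have := mul_le_mul_of_nonneg_left (show k * l - s / 2 ≤ T by linarith) hCx.le
            linarith
          have h7 := mul_le_mul_of_nonneg_left h6 hln.le
          have hp : 0 < 1 + l * C x := by positivity
          refine le_of_mul_le_mul_left ?_ hp
          refine le_trans ?_ h3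
          linarith
    refine le_trans ?_ (key k hkT)
    refine mul_le_mul_of_nonneg_left ?_ hβ.le
    linarith

end WeightedGraph

/-! ### The main theorem. -/

theorem theorem6p3 {X : Type*} [Countable X] (G : WeightedGraph X) (hG : G.IsConnected)
    (p : ℝ) (hp : 1 ≤ p) (hC : 1 < p → G.CondC p)
    (q : ℝ) (hq : 0 < q) (hq1 : q ≠ 1)
    (u₀ : X → ℝ) (hu₀ : ∀ x, 0 ≤ u₀ x) (hu₀p : G.MemEllp p u₀)
    (hu₀b : BddAbove (Set.range fun x => |u₀ x|))
    (M : ℝ) (hM : M = ⨆ x, |u₀ x|) :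
    ∃ u : ℝ → X → ℝ,
      -- `u` is a mild solution, and the only one whose approximations take values in `Ω_p`
      G.IsMildSolution p (absorption q) (G.domA p (absorption q)) 0 u₀ u ∧
      (∀ E : ℕ → Finset X, WeightedGraph.IsExhaustion E →
        G.IsMildSolution p (absorption q) (G.Omega p (absorption q) E) 0 u₀ u ∧
        ∀ v : ℝ → X → ℝ,
          G.IsMildSolution p (absorption q) (G.Omega p (absorption q) E) 0 u₀ v →
          ∀ t, 0 ≤ t → v t = u t) ∧
      -- the barrier bounds and extinction in finite time
      (q < 1 →
        (∀ t, 0 < t → ∀ x, 0 ≤ u t x ∧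
          u t x ≤ (max (M ^ (1 - q) - (1 - q) * t) 0) ^ (1 / (1 - q))) ∧
        ∀ t, M ^ (1 - q) / (1 - q) ≤ t → ∀ x, u t x = 0) ∧
      (1 < q → (∃ x, u₀ x ≠ 0) →
        ∀ t, 0 < t → ∀ x, 0 < u t x ∧
          u t x ≤ (1 / M ^ (q - 1) + (q - 1) * t) ^ (-(1 / (q - 1)))) := by
  have hp0 : 0 < p := by linarith
  have hM0 : 0 ≤ M := by rw [hM]; exact Real.iSup_nonneg fun x => abs_nonneg _
  have hu₀M : ∀ x, u₀ x ≤ M := fun x => by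
    rw [hM]; exact (le_abs_self _).trans (le_ciSup hu₀b x)
  obtain ⟨u, w, hw0, hw, hlim, hmild⟩ :=
    WeightedGraph.exists_isMildSolution hp hC hq ⟨hu₀, ⟨M, hM0, hu₀M⟩, hu₀p⟩
  have hnonneg : ∀ t, 0 ≤ t → ∀ x, 0 ≤ u t x := fun t ht x => by
    refine ge_of_tendsto' (hlim t ht x) fun n => ?_
    cases ⌈t * ((n : ℝ) + 1)⌉₊ with
    | zero => rw [hw0]; exact hu₀ x
    | succ k => exact (hw n k).nonneg x
  have hw0M : ∀ n x, w n 0 x ≤ M := fun n x => by rw [hw0]; exact hu₀M x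
  refine ⟨u, ?_, fun E hE => ?_, fun hq' => ?_, fun hq' hne t ht x => ?_⟩
  · obtain ⟨E, hE⟩ := WeightedGraph.exists_isExhaustion (X := X)
    exact hmild _ fun v hv => (hv E hE).1
  · have hmE := hmild (G.Omega p (absorption q) E) fun v hv => hv E hE
    refine ⟨hmE, fun v hv t ht => ?_⟩
    refine WeightedGraph.IsMildSolution.unique hp (antitone_absorption hq) hu₀p (fun e he => ?_)
      hv hmE ht
    obtain ⟨z, hz, hze⟩ :=
      WeightedGraph.exists_omega_ellpNorm_lt hp hC (absorption_zero q) hu₀p he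
    exact ⟨z, hz E hE, hze⟩
  · have hq1 : 0 < 1 - q := by linarith
    have hb : ∀ t, 0 ≤ t → ∀ x, u t x ≤ (max (M ^ (1 - q) - (1 - q) * t) 0) ^ (1 / (1 - q)) :=
      fun t ht x => WeightedGraph.le_barrier_of_lt_one hq hq' hM0 hw0M hw (hlim t ht x)
    refine ⟨fun t ht x => ⟨hnonneg t ht.le x, hb t ht.le x⟩, fun t ht x => ?_⟩
    have ht0 : 0 ≤ t := le_trans (div_nonneg (Real.rpow_nonneg hM0 _) hq1.le) ht
    refine le_antisymm ((hb t ht0 x).trans_eq ?_) (hnonneg t ht0 x)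
    rw [div_le_iff₀ hq1] at ht
    rw [max_eq_right (by linarith), Real.zero_rpow (by positivity)]
  · have hMpos : 0 < M := by
      obtain ⟨y, hy⟩ := hne
      exact ((hu₀ y).lt_of_ne (Ne.symm hy)).trans_le (hu₀M y)
    exact ⟨WeightedGraph.pos_of_one_lt hG hq' hMpos hw0 hu₀ hu₀M hw hne ht (hlim t ht.le x),
      WeightedGraph.le_barrier_of_one_lt hq' hMpos hw0M hw ht.le (hlim t ht.le x)⟩
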